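/- For $\alpha\in(1,2]$ put $\beta=\alpha/(\alpha-1)$ and, for $a>0$, $x\in\mathbb R$, $$H_{a,\alpha}(x)=\begin{cases}\dfrac{x^2}{2}&\text{if }|x|\le a,\\[1mm] a^{2-\beta}\dfrac{|x|^\beta}{\beta}+a^2\dfrac{\beta-2}{2\beta}&\text{if }|x|\ge a.\end{cases}$$ A probability measure $\mu$ on $\mathbb R$ is said to satisfy a logarithmic Sobolev inequality of function $H_{a,\alpha}$ if there is a constant $C\in(0,\infty)$ such that for every $C^\infty$ function $f:\mathbb R\to\mathbb R$ with $f\in L^2(\mu)$, $$\int f^2\log\frac{f^2}{\int f^2\,d\mu}\,d\mu\;\le\; C\int H_{a,\alpha}\!\left(\frac{f'}{f}\right)f^2\,d\mu ,$$ where both sides may be $+\infty$, and the integrand on the right is taken to be $0$ at the points where $f=0$ (that is, $f'/f=\infty$ there, including $0/0=\infty$, with $H_{a,\alpha}(\infty)=\infty$ and $\infty\cdot 0=0$). For $\alpha\in(1,2]$ and $b\in\mathbb R$ consider the measures on $\mathbb R$ $$d\tau_\alpha(x)=\exp\left(-|x|^\alpha-|x|^{\alpha-1}\cos x\right)\frac{dx}{Z_\alpha},\qquad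 d\gamma_{\alpha,b}(x)=(1+x)^b e^{-x^\alpha}\mathbf 1_{x\ge0}\frac{dx}{Z_{\alpha,b}},$$ where $Z_\alpha$ and $Z_{\alpha,b}$ are the integrals of the respective densities. **Proposition.** There exists $a>0$ such that for every $\alpha\in(1,2]$ and every $b\in\mathbb R$, $\tau_\alpha$ and $\gamma_{\alpha,b}$ are probability measures and each of them satisfies a logarithmic Sobolev inequality of function $H_{a,\alpha}$ (with a constant $C$ that may depend on the measure). -/

import Mathlib

open MeasureTheory Set
open scoped ENNReal ContDiff

noncomputable section

namespace ModLSI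

/-- The function `H_{a,α}` on `ℝ`, for `1 < α ≤ 2` and `a > 0`. With `β = α / (α - 1)` the exponent
conjugate to `α`, it is `x² / 2` for `|x| ≤ a` and
`a^(2-β) |x|^β / β + a² (β - 2) / (2β)` for `|x| ≥ a` (the two formulas agree at `|x| = a`). -/
def H (a α x : ℝ) : ℝ :=
  if |x| ≤ a then x ^ 2 / 2
  else a ^ (2 - α.conjExponent) * (|x| ^ α.conjExponent / α.conjExponent)
    + a ^ 2 * ((α.conjExponent - 2) / (2 * α.conjExponent))

/-- The entropy `Ent_μ(g) = ∫ g log (g / ∫ g dμ) dμ` of a nonnegative `μ`-integrable function `g`,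
for a probability measure `μ`. As `g log (g / ∫ g dμ)` is bounded below, this integral always
exists in `]-∞, +∞]`, and it is `+∞` exactly when the integrand is not integrable. -/
def entropy (μ : Measure ℝ) (g : ℝ → ℝ) : EReal :=
  open Classical in
  if Integrable (fun x => g x * Real.log (g x / ∫ y, g y ∂μ)) μ then
    ((∫ x, g x * Real.log (g x / ∫ y, g y ∂μ) ∂μ : ℝ) : EReal)
  else ⊤

/-- `H_{a,α}(f'/f)` as a function with values in `[0, +∞]`: where `f` vanishes the quotient `f'/f`
is infinite (also when `f'` vanishes there: `0 / 0 = ∞`), and `H_{a,α}(∞) = ∞`. -/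
def HLogDeriv (a α : ℝ) (f : ℝ → ℝ) (x : ℝ) : ℝ≥0∞ :=
  open Classical in
  if f x = 0 then ⊤ else ENNReal.ofReal (H a α (deriv f x / f x))

/-- The energy `∫ H_{a,α}(f'/f) f² dμ ∈ [0, +∞]`, with the convention `∞ · 0 = 0` of measure theory,
so that the set where `f` vanishes does not contribute. -/
def energy (a α : ℝ) (μ : Measure ℝ) (f : ℝ → ℝ) : ℝ≥0∞ :=
  ∫⁻ x, HLogDeriv a α f x * ENNReal.ofReal (f x ^ 2) ∂μ

/-- `LSI_{a,α}(C)`: `Ent_μ(f²) ≤ C ∫ H_{a,α}(f'/f) f² dμ` for every `C^∞` function `f` on `ℝ` that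
is in `L²(μ)`. Both sides may be `+∞`. -/
def SatisfiesLSI (a α C : ℝ) (μ : Measure ℝ) : Prop :=
  ∀ f : ℝ → ℝ, ContDiff ℝ ∞ f → MemLp f 2 μ →
    entropy μ (fun x => f x ^ 2) ≤ ((ENNReal.ofReal C * energy a α μ f : ℝ≥0∞) : EReal)

/-- The unnormalised density `exp (-|x|^α - |x|^(α-1) cos x)` of `τ_α`. -/
def tauDensity (α x : ℝ) : ℝ :=
  Real.exp (-|x| ^ α - |x| ^ (α - 1) * Real.cos x)

/-- The measure `dτ_α(x) = exp (-|x|^α - |x|^(α-1) cos x) dx / Z_α`, where `Z_α` is the total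
integral of the density. -/
def tau (α : ℝ) : Measure ℝ :=
  volume.withDensity fun x => ENNReal.ofReal (tauDensity α x / ∫ y, tauDensity α y)

/-- The unnormalised density `(1 + x)^b exp (-x^α)`, `x ≥ 0`, of `γ_{α,b}`. -/
def gammaDensity (α b x : ℝ) : ℝ :=
  (1 + x) ^ b * Real.exp (-x ^ α)

/-- The measure `dγ_{α,b}(x) = (1 + x)^b exp (-x^α) 1_{x ≥ 0} dx / Z_{α,b}`, where `Z_{α,b}` is the
integral of the density over `[0, ∞[`. -/
def gamma (α b : ℝ) : Measure ℝ :=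
  (volume.restrict (Ici (0 : ℝ))).withDensity fun x =>
    ENNReal.ofReal (gammaDensity α b x / ∫ y in Ici (0 : ℝ), gammaDensity α b y)

end ModLSI

end

open MeasureTheory Set
open scoped ENNReal ContDiff

namespace ModLSI

/-! Put β = α/(α-1) and E(k) = ∫ (k'² + |k'/k|^β k²) dμ. As β ≥ 2, E is at most a constant times the
energy built on H_{1,α}, so a = 1 serves and it is enough to bound the entropy of f² by a multiple
of E(f).

Three estimates on μ suffice, collected in `WeightedBounds`: a Hardy inequality for k - k(0), a
bound of ∫ (1+|x|)^α k² by ∫ k² + E(k), and a pointwise bound which yields log k² ≤ C + C(1+|x|)^α +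
∫ k² + E(k) almost everywhere. The last one replaces the logarithm by the weight (1+|x|)^α, and the
second one integrates this weight against k².

If ∫ (f - f(0))² ≥ f(0)², Hardy gives ∫ f² ≤ 4C E(f), and the argument applied to f itself closes
(`entropy_le_of_integral_sq_le`). Otherwise f is close to the constant m = f(0). With g = f/m, the
entropy is at most m² ∫ (g² log g² - g² + 1). Where g is bounded the integrand is O((g-1)²), which
Hardy controls. Where g is large it is controlled by the truncation `cut n g`, whose L² norm and
energy are both bounded by E(g) (`exists_entropy_le_of_integral_sub_lt`).

The three estimates hold for exp(-V) dx on a half-line as soon as x V'(x) ≥ c(1+x)^α - B and V ≤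
K(1+x)^α (`HalfLinePotential`), by integrating derivatives of k² times well chosen weights. For γ
the factor (1+x)^b changes x V' by a bounded amount. For τ the oscillating term contributes -x^α sin
x, which α x^α dominates because α > 1; τ is even, hence the sum of a half-line measure and its
reflection. -/

/-- The function `|k'/k|^β k²`, which vanishes where `k` does. -/
noncomputable def powEnergy (β : ℝ) (k k' : ℝ → ℝ) (x : ℝ) : ℝ :=
  |k' x / k x| ^ β * k x ^ 2

theorem powEnergy_nonneg (β : ℝ) (k k' : ℝ → ℝ) (x : ℝ) : 0 ≤ powEnergy β k k' x := by
  unfold powEnergy; positivity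

theorem measurable_powEnergy (β : ℝ) {k k' : ℝ → ℝ} (hk : Measurable k) (hk' : Measurable k') :
    Measurable (powEnergy β k k') := by
  unfold powEnergy
  exact (((hk'.div hk).abs).pow_const β).mul (hk.pow_const 2)

/-- The inequalities on a measure from which the modified logarithmic Sobolev inequality follows:
a Hardy inequality, a moment bound of exponent `α`, and a weighted pointwise bound. -/
structure WeightedBounds (α : ℝ) (μ : Measure ℝ) (C : ℝ) : Prop where
  one_le : 1 ≤ C
  hardy : ∀ k k' : ℝ → ℝ, (∀ x, HasDerivAt k (k' x) x) → Continuous k' →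
    ∫⁻ x, ENNReal.ofReal ((k x - k 0) ^ 2) ∂μ ≤
      ENNReal.ofReal C * ∫⁻ x, ENNReal.ofReal (k' x ^ 2) ∂μ
  moment : ∀ k k' : ℝ → ℝ, (∀ x, HasDerivAt k (k' x) x) → Continuous k' →
    ∫⁻ x, ENNReal.ofReal ((1 + |x|) ^ α * k x ^ 2) ∂μ ≤
      ENNReal.ofReal C *
        ∫⁻ x, ENNReal.ofReal (k x ^ 2 + powEnergy α.conjExponent k k' x) ∂μ
  pointwise : ∀ k k' : ℝ → ℝ, (∀ x, HasDerivAt k (k' x) x) → Continuous k' →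
    ∀ᵐ x ∂μ, ENNReal.ofReal (k x ^ 2) ≤ ENNReal.ofReal (C * Real.exp (C * (1 + |x|) ^ α)) *
      ∫⁻ y, ENNReal.ofReal (k y ^ 2 + k' y ^ 2 + powEnergy α.conjExponent k k' y) ∂μ

/-! ### Integration by parts as an inequality between lower integrals, and Young's inequality. -/

theorem ofReal_integral_le_lintegral {X : Type*} [MeasurableSpace X] {μ : Measure X} {F : X → ℝ}
    (hF : Integrable F μ) :
    ENNReal.ofReal (∫ x, F x ∂μ) ≤ ∫⁻ x, ENNReal.ofReal (F x) ∂μ := by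
  rw [integral_eq_lintegral_pos_part_sub_lintegral_neg_part hF]
  exact (ENNReal.ofReal_le_ofReal (sub_le_self _ ENNReal.toReal_nonneg)).trans
    ENNReal.ofReal_toReal_le

/-- The integral of G is p R - p 0 ≥ 0, so it may be added to that of G₂ for free: boundary terms
are discarded by sign. No regularity is asked of G₁, which will contain `powEnergy`, possibly
discontinuous at zeros of k. Differentiability on the open interval only allows V' to blow up at 0.
-/
theorem lintegral_Ioc_le_of_hasDerivAt {R : ℝ} (hR : 0 ≤ R) {p G G₁ G₂ : ℝ → ℝ}
    (hp : ContinuousOn p (Icc 0 R)) (hd : ∀ x ∈ Ioo 0 R, HasDerivAt p (G x) x)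
    (hG : ContinuousOn G (Icc 0 R)) (hle : p 0 ≤ p R) (hG₂ : ContinuousOn G₂ (Icc 0 R))
    (h0 : ∀ x ∈ Ioc 0 R, 0 ≤ G₂ x) (h : ∀ x ∈ Ioc 0 R, G x + G₂ x ≤ G₁ x) :
    ∫⁻ x in Ioc 0 R, ENNReal.ofReal (G₂ x) ≤ ∫⁻ x in Ioc 0 R, ENNReal.ofReal (G₁ x) := by
  have iG : IntegrableOn G (Ioc 0 R) := hG.integrableOn_Icc.mono_set Ioc_subset_Icc_self
  have iG₂ : IntegrableOn G₂ (Ioc 0 R) := hG₂.integrableOn_Icc.mono_set Ioc_subset_Icc_self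
  have hint : ∫ x in Ioc 0 R, G x = p R - p 0 := by
    rw [← intervalIntegral.integral_of_le hR]
    exact intervalIntegral.integral_eq_sub_of_hasDerivAt_of_le hR hp hd
      ((intervalIntegrable_iff_integrableOn_Ioc_of_le hR).2 iG)
  calc ∫⁻ x in Ioc 0 R, ENNReal.ofReal (G₂ x)
      = ENNReal.ofReal (∫ x in Ioc 0 R, G₂ x) :=
        (ofReal_integral_eq_lintegral_ofReal iG₂
          ((ae_restrict_iff' measurableSet_Ioc).2 (Filter.Eventually.of_forall h0))).symm
    _ ≤ ENNReal.ofReal (∫ x in Ioc 0 R, (G x + G₂ x)) := by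
        apply ENNReal.ofReal_le_ofReal
        rw [integral_add iG iG₂, hint]
        linarith
    _ ≤ ∫⁻ x in Ioc 0 R, ENNReal.ofReal (G x + G₂ x) := ofReal_integral_le_lintegral (iG.add iG₂)
    _ ≤ _ := setLIntegral_mono' measurableSet_Ioc fun x hx => ENNReal.ofReal_le_ofReal (h x hx)

theorem lintegral_Ioi_le_of_forall_nat {F : ℝ → ℝ≥0∞} {A : ℝ≥0∞}
    (h : ∀ n : ℕ, ∫⁻ x in Ioc 0 (n : ℝ), F x ≤ A) : ∫⁻ x in Ioi (0 : ℝ), F x ≤ A := by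
  have hU : Ioi (0 : ℝ) = ⋃ n : ℕ, Ioc 0 (n : ℝ) := by
    ext x
    simp only [mem_Ioi, mem_iUnion, mem_Ioc]
    refine ⟨fun hx => ?_, fun ⟨n, hx⟩ => hx.1⟩
    obtain ⟨n, hn⟩ := exists_nat_ge x
    exact ⟨n, hx, hn⟩
  have hdir : Directed (· ⊆ ·) fun n : ℕ => Ioc 0 (n : ℝ) :=
    Monotone.directed_le fun m n hmn => Ioc_subset_Ioc_right (Nat.cast_le.2 hmn)
  rw [hU, setLIntegral_iUnion_of_directed _ hdir]
  exact iSup_le h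

theorem mul_le_rpow_add_rpow {α : ℝ} (hα : 1 < α) {ε : ℝ} (hε : 0 < ε) :
    ∃ C : ℝ, 0 ≤ C ∧ ∀ x y : ℝ, 0 ≤ x → 0 ≤ y →
      x * y ≤ ε * x ^ α + C * y ^ α.conjExponent := by
  have hc := Real.HolderConjugate.conjExponent hα
  have hβ : 0 < α.conjExponent := hc.symm.pos
  have hα0 : 0 < α := by linarith
  refine ⟨(ε ^ (-α⁻¹)) ^ α.conjExponent / α.conjExponent, by positivity, fun x y hx hy => ?_⟩
  have h := Real.young_inequality_of_nonneg (a := ε ^ (α⁻¹) * x) (b := ε ^ (-α⁻¹) * y)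
    (by positivity) (by positivity) hc
  have e1 : ε ^ (α⁻¹) * x * (ε ^ (-α⁻¹) * y) = x * y := by
    rw [Real.rpow_neg hε.le]
    have : ε ^ (α⁻¹) ≠ 0 := by positivity
    field_simp
  rw [e1, Real.mul_rpow (by positivity) hx, Real.mul_rpow (by positivity) hy,
    ← Real.rpow_mul hε.le, inv_mul_cancel₀ hα0.ne', Real.rpow_one] at h
  have h2 : ε * x ^ α / α ≤ ε * x ^ α := div_le_self (by positivity) hα.le
  calc x * y ≤ _ := h
    _ ≤ ε * x ^ α + (ε ^ (-α⁻¹)) ^ α.conjExponent * y ^ α.conjExponent / α.conjExponent := by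
        linarith
    _ = _ := by ring

/-! ### The three weighted estimates for exp(-V) on the half-line. -/

/-- Regularity and growth of a potential `V` on `[0, ∞[` whose derivative is `q x / x`. -/
structure HalfLinePotential (α : ℝ) (V q : ℝ → ℝ) (c B K : ℝ) : Prop where
  c_pos : 0 < c
  B_nonneg : 0 ≤ B
  K_nonneg : 0 ≤ K
  meas : Measurable V
  cont : ContinuousOn V (Ici 0)
  q_cont : ContinuousOn q (Ici 0)
  deriv : ∀ x, 0 < x → HasDerivAt V (q x / x) x
  q_ge : ∀ x, 0 < x → c * (1 + x) ^ α - B ≤ q x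
  V_le : ∀ x, 0 < x → V x ≤ K * (1 + x) ^ α

/-- The measure `exp (-V x) dx` on `]0, ∞[`. -/
noncomputable def halfLineMeasure (V : ℝ → ℝ) : Measure ℝ :=
  (volume.restrict (Ioi (0 : ℝ))).withDensity fun x => ENNReal.ofReal (Real.exp (-V x))

theorem lintegral_halfLineMeasure {V : ℝ → ℝ} (hV : Measurable V) (F : ℝ → ℝ) :
    ∫⁻ x, ENNReal.ofReal (F x) ∂halfLineMeasure V =
      ∫⁻ x in Ioi 0, ENNReal.ofReal (Real.exp (-V x) * F x) := by
  unfold halfLineMeasure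
  rw [lintegral_withDensity_eq_lintegral_mul_non_measurable _ (by fun_prop)
    (Filter.Eventually.of_forall fun x => ENNReal.ofReal_lt_top)]
  refine lintegral_congr fun x => ?_
  rw [Pi.mul_apply, ENNReal.ofReal_mul (Real.exp_pos _).le]

theorem two_mul_mul_le_powEnergy {α ε C : ℝ}
    (hC : ∀ x y : ℝ, 0 ≤ x → 0 ≤ y → x * y ≤ ε * x ^ α + C * y ^ α.conjExponent)
    (k k' : ℝ → ℝ) {x t : ℝ} (ht : 0 ≤ t) :
    t * |k x * k' x| ≤ ε * t ^ α * k x ^ 2 + C * powEnergy α.conjExponent k k' x := by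
  unfold powEnergy
  by_cases h0 : k x = 0
  · simp [h0]
  · have h := hC t |k' x / k x| ht (abs_nonneg _)
    have e : t * |k x * k' x| = (t * |k' x / k x|) * k x ^ 2 := by
      rw [← sq_abs (k x), abs_mul, abs_div]
      have : |k x| ≠ 0 := abs_ne_zero.2 h0
      field_simp
    rw [e]
    nlinarith [mul_le_mul_of_nonneg_right h (sq_nonneg (k x))]

namespace HalfLinePotential

variable {α : ℝ} {V q : ℝ → ℝ} {c B K : ℝ}

/-- Integrate the derivative of x k² exp(-V). The factor x turns V' into q = x V', which is
continuous up to 0 and bounded below by c(1+x)^α - B; the cross term 2x k k' is absorbed by Young's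
inequality. -/
theorem moment (h : HalfLinePotential α V q c B K) (hα : 1 < α) :
    ∃ C : ℝ, 1 ≤ C ∧ ∀ k k' : ℝ → ℝ, (∀ x, HasDerivAt k (k' x) x) → Continuous k' →
    ∫⁻ x, ENNReal.ofReal ((1 + |x|) ^ α * k x ^ 2) ∂halfLineMeasure V ≤
      ENNReal.ofReal C * ∫⁻ x, ENNReal.ofReal (k x ^ 2 + powEnergy α.conjExponent k k' x)
        ∂halfLineMeasure V := by
  have hc := h.c_pos
  have hB := h.B_nonneg
  -- The cross term carries a factor 2, so ε = c/4 uses up half of the gain c(1+x)^α k².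
  obtain ⟨C₁, hC₁, hY⟩ := mul_le_rpow_add_rpow hα (ε := c / 4) (by positivity)
  set A : ℝ := (2 / c) * (1 + B + 2 * C₁) with hA
  have hA0 : 0 ≤ A := by positivity
  refine ⟨A + 1, by linarith, fun k k' hk hk' => ?_⟩
  have ck : Continuous k := continuous_iff_continuousAt.2 fun x => (hk x).continuousAt
  rw [lintegral_halfLineMeasure h.meas, lintegral_halfLineMeasure h.meas,
    ← lintegral_const_mul' _ _ ENNReal.ofReal_ne_top]
  refine lintegral_Ioi_le_of_forall_nat fun n => ?_
  have hR : (0 : ℝ) ≤ n := n.cast_nonneg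
  have cV : ContinuousOn V (Icc 0 (n : ℝ)) := h.cont.mono Icc_subset_Ici_self
  have cq : ContinuousOn q (Icc 0 (n : ℝ)) := h.q_cont.mono Icc_subset_Ici_self
  have cT : ContinuousOn (fun x : ℝ => (1 + |x|) ^ α) (Icc 0 (n : ℝ)) :=
    ((continuous_const.add continuous_abs).rpow_const
      fun x => Or.inr (by linarith)).continuousOn
  have key := lintegral_Ioc_le_of_hasDerivAt hR
    (p := fun x => (2 / c) * (x * k x ^ 2 * Real.exp (-V x)))
    (G := fun x => (2 / c) * (Real.exp (-V x) * (k x ^ 2 + 2 * x * k x * k' x - k x ^ 2 * q x)))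
    (G₁ := fun x => (A + 1) *
      (Real.exp (-V x) * (k x ^ 2 + powEnergy α.conjExponent k k' x)))
    (G₂ := fun x => Real.exp (-V x) * ((1 + |x|) ^ α * k x ^ 2))
    (by fun_prop) ?_ (by fun_prop) (by simp; positivity) (by fun_prop)
    (fun x _ => by positivity) ?_
  · refine key.trans ((setLIntegral_mono' measurableSet_Ioc fun x _ => ?_).trans
      (lintegral_mono_set Ioc_subset_Ioi_self))
    rw [← ENNReal.ofReal_mul (by linarith)]
  · intro x hx
    have := (((hasDerivAt_id x).mul ((hk x).pow 2)).mul
      ((h.deriv x hx.1).neg.exp)).const_mul (2 / c)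
    refine HasDerivAt.congr_deriv this ?_
    simp only [Pi.mul_apply, Pi.pow_apply, Pi.neg_apply, id, Nat.cast_ofNat]
    have := hx.1.ne'
    field_simp
    ring
  · intro x hx
    have hx0 : 0 < x := hx.1
    have hq := h.q_ge x hx0
    have h1 := two_mul_mul_le_powEnergy hY k k' (x := x) (t := 1 + x) (by linarith)
    have hD := powEnergy_nonneg α.conjExponent k k' x
    set D := powEnergy α.conjExponent k k' x
    have h2 : x * (k x * k' x) ≤ (1 + x) * |k x * k' x| := by
      nlinarith [le_abs_self (k x * k' x), abs_nonneg (k x * k' x)]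
    rw [abs_of_pos hx0]
    have hT : 0 ≤ (1 + x) ^ α := by positivity
    set T := (1 + x) ^ α
    have hs : 0 ≤ k x ^ 2 := sq_nonneg _
    have h3 := mul_le_mul_of_nonneg_left hq hs
    have h4 : k x ^ 2 + 2 * x * k x * k' x - k x ^ 2 * q x + c / 2 * (T * k x ^ 2) ≤
        (1 + B + 2 * C₁) * (k x ^ 2 + D) := by
      have := mul_nonneg hB hD
      have := mul_nonneg hC₁ hs
      nlinarith
    have h5 : (2 / c) * (k x ^ 2 + 2 * x * k x * k' x - k x ^ 2 * q x) + T * k x ^ 2 ≤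
        A * (k x ^ 2 + D) := by
      have := mul_le_mul_of_nonneg_left h4 (show 0 ≤ 2 / c by positivity)
      have e : 2 / c * (c / 2 * (T * k x ^ 2)) = T * k x ^ 2 := by field_simp
      rw [hA, mul_assoc, ← e, ← mul_add]
      linarith
    have h6 := mul_le_mul_of_nonneg_left
      (h5.trans (show _ ≤ (A + 1) * (k x ^ 2 + D) by nlinarith)) (Real.exp_pos (-V x)).le
    linarith

/-- Let g = k - k(0) and integrate the derivative of x/(1+x) g² exp(-V). The weight vanishes at 0,
which removes the singularity of V', and is at most 1, so the cross term costs only k'². Since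
q/(1+x) ≥ c - B/(1+x), the g² terms have the right sign far out; on the remaining interval ]0, L]
the density is bounded above and below, and g(0) = 0 gives an unweighted Hardy inequality. -/
theorem hardy (h : HalfLinePotential α V q c B K) (hα : 1 < α) :
    ∃ C : ℝ, 1 ≤ C ∧ ∀ k k' : ℝ → ℝ, (∀ x, HasDerivAt k (k' x) x) → Continuous k' →
    ∫⁻ x, ENNReal.ofReal ((k x - k 0) ^ 2) ∂halfLineMeasure V ≤
      ENNReal.ofReal C * ∫⁻ x, ENNReal.ofReal (k' x ^ 2) ∂halfLineMeasure V := by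
  have hc := h.c_pos
  have hB := h.B_nonneg
  -- For x > L, (B+1)/(1+x) ≤ c/2. Of the remaining -c/2, one c/4 pays for the cross term and the
  -- other is the gain.
  set L : ℝ := (2 * (B + 1) + c) / c + 1 with hL
  have hL0 : 0 < L := by positivity
  obtain ⟨m, hm0, M, hM0, hmM⟩ : ∃ m > 0, ∃ M > 0, ∀ x ∈ Icc 0 L,
      m ≤ Real.exp (-V x) ∧ Real.exp (-V x) ≤ M := by
    have cE : ContinuousOn (fun x => Real.exp (-V x)) (Icc 0 L) :=
      ((h.cont.mono Icc_subset_Ici_self).neg).rexp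
    have hne : (Icc 0 L).Nonempty := nonempty_Icc.2 hL0.le
    obtain ⟨a, ha, ha'⟩ := isCompact_Icc.exists_isMinOn hne cE
    obtain ⟨b, hb, hb'⟩ := isCompact_Icc.exists_isMaxOn hne cE
    exact ⟨_, Real.exp_pos (-V a), _, Real.exp_pos (-V b), fun x hx => ⟨ha' hx, hb' hx⟩⟩
  set κ : ℝ := B + 1 + c / 2 with hκ
  set A : ℝ := (4 / c) * (4 / c + κ * M * (4 * L ^ 2) / m) with hA
  have hA0 : 0 ≤ A := by positivity
  refine ⟨A + 1, by linarith, fun k k' hk hk' => ?_⟩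
  have ck : Continuous k := continuous_iff_continuousAt.2 fun x => (hk x).continuousAt
  rw [lintegral_halfLineMeasure h.meas, lintegral_halfLineMeasure h.meas]
  set I := ∫⁻ x in Ioi (0 : ℝ), ENNReal.ofReal (Real.exp (-V x) * k' x ^ 2) with hI
  set g : ℝ → ℝ := fun x => k x - k 0 with hg
  have cg : Continuous g := ck.sub continuous_const
  have dg : ∀ x, HasDerivAt g (k' x) x := fun x => (hk x).sub_const _
  have g0 : g 0 = 0 := by simp [hg]
  have hgx : ∀ x, k x - k 0 = g x := fun x => rfl
  simp_rw [hgx]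
  clear_value g I
  -- the part near the origin
  have loc : ∫⁻ x in Ioc 0 L, ENNReal.ofReal (κ * (Real.exp (-V x) * g x ^ 2)) ≤
      ENNReal.ofReal (κ * M * (4 * L ^ 2) / m) * I := by
    -- The weight L - x vanishes at L and g vanishes at 0, so there is no boundary term at either
    -- end.
    have key := lintegral_Ioc_le_of_hasDerivAt hL0.le
      (p := fun x => 2 * κ * M * ((L - x) * g x ^ 2))
      (G := fun x => 2 * κ * M * (-g x ^ 2 + (L - x) * (2 * g x * k' x)))
      (G₁ := fun x => κ * M * (4 * L ^ 2) / m * (Real.exp (-V x) * k' x ^ 2))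
      (G₂ := fun x => κ * M * g x ^ 2)
      (by fun_prop) ?_ (by fun_prop) (by simp [g0]) (by fun_prop)
      (fun x _ => by positivity) ?_
    · calc _ ≤ ∫⁻ x in Ioc 0 L, ENNReal.ofReal (κ * M * g x ^ 2) := by
            refine setLIntegral_mono' measurableSet_Ioc fun x hx => ENNReal.ofReal_le_ofReal ?_
            have := (hmM x (Ioc_subset_Icc_self hx)).2
            rw [mul_assoc]
            gcongr
        _ ≤ _ := key
        _ ≤ _ := by
            rw [hI, ← lintegral_const_mul' _ _ ENNReal.ofReal_ne_top]
            refine (setLIntegral_mono' measurableSet_Ioc fun x _ => ?_).trans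
              (lintegral_mono_set Ioc_subset_Ioi_self)
            rw [← ENNReal.ofReal_mul (by positivity)]
    · intro x _
      have := ((((hasDerivAt_id x).const_sub L)).mul ((dg x).pow 2)).const_mul (2 * κ * M)
      refine HasDerivAt.congr_deriv this ?_
      simp only [Pi.pow_apply, id, Nat.cast_ofNat]
      ring
    · intro x hx
      have h1 : 2 * (-g x ^ 2 + (L - x) * (2 * g x * k' x)) + g x ^ 2 ≤ 4 * L ^ 2 * k' x ^ 2 := by
        have h3 : (L - x) ^ 2 ≤ L ^ 2 := by
          have := hx.1
          have := hx.2
          nlinarith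
        nlinarith [sq_nonneg (g x - 2 * (L - x) * k' x),
          mul_le_mul_of_nonneg_right h3 (sq_nonneg (k' x))]
      have h2 : (4 * L ^ 2 * k' x ^ 2) * m ≤ (4 * L ^ 2 * k' x ^ 2) * Real.exp (-V x) := by
        gcongr
        exact (hmM x (Ioc_subset_Icc_self hx)).1
      have h3 : 4 * L ^ 2 * k' x ^ 2 ≤ 4 * L ^ 2 / m * (Real.exp (-V x) * k' x ^ 2) := by
        rw [div_mul_eq_mul_div, le_div_iff₀ hm0]
        linarith
      have h4 := mul_le_mul_of_nonneg_left (h1.trans h3) (show 0 ≤ κ * M by positivity)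
      calc _ = κ * M * (2 * (-g x ^ 2 + (L - x) * (2 * g x * k' x)) + g x ^ 2) := by ring
        _ ≤ _ := h4
        _ = _ := by ring
  have main : ∀ n : ℕ, ∫⁻ x in Ioc 0 (n : ℝ), ENNReal.ofReal (c / 4 *
      (Real.exp (-V x) * g x ^ 2)) ≤ ENNReal.ofReal (4 / c + κ * M * (4 * L ^ 2) / m) * I := by
    intro n
    have hR : (0 : ℝ) ≤ n := n.cast_nonneg
    have cV : ContinuousOn V (Icc 0 (n : ℝ)) := h.cont.mono Icc_subset_Ici_self
    have cq : ContinuousOn q (Icc 0 (n : ℝ)) := h.q_cont.mono Icc_subset_Ici_self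
    have n1 : ∀ x ∈ Icc 0 (n : ℝ), 1 + x ≠ 0 := fun x hx => by linarith [hx.1]
    have n2 : ∀ x ∈ Icc 0 (n : ℝ), (1 + x) ^ 2 ≠ 0 := fun x hx => pow_ne_zero _ (n1 x hx)
    have key := lintegral_Ioc_le_of_hasDerivAt hR
      (p := fun x => x / (1 + x) * g x ^ 2 * Real.exp (-V x))
      (G := fun x => Real.exp (-V x) * (1 / (1 + x) ^ 2 * g x ^ 2 +
        x / (1 + x) * (2 * g x * k' x) - g x ^ 2 * (q x / (1 + x))))
      (G₁ := fun x => 4 / c * (Real.exp (-V x) * k' x ^ 2) +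
        (Ioc 0 L).indicator (fun x => κ * (Real.exp (-V x) * g x ^ 2)) x)
      (G₂ := fun x => c / 4 * (Real.exp (-V x) * g x ^ 2))
      ?_ ?_ ?_ (by simp; positivity) (by fun_prop)
      (fun x _ => by positivity) ?_
    · refine key.trans ((lintegral_mono_set Ioc_subset_Ioi_self).trans ?_)
      refine (lintegral_mono fun x => ENNReal.ofReal_add_le).trans ?_
      have mV := h.meas
      have mk' := hk'.measurable
      rw [lintegral_add_left (by fun_prop), ENNReal.ofReal_add (by positivity) (by positivity),
        add_mul]
      refine add_le_add ?_ (le_trans (le_of_eq ?_) loc)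
      · rw [hI, ← lintegral_const_mul' _ _ ENNReal.ofReal_ne_top]
        refine lintegral_mono fun x => ?_
        rw [← ENNReal.ofReal_mul (by positivity)]
      · have : ∀ x, ENNReal.ofReal ((Ioc 0 L).indicator
            (fun x => κ * (Real.exp (-V x) * g x ^ 2)) x) =
            (Ioc 0 L).indicator (fun x => ENNReal.ofReal (κ * (Real.exp (-V x) * g x ^ 2))) x := by
          intro x
          by_cases hx : x ∈ Ioc 0 L <;> simp [hx]
        simp_rw [this]
        rw [lintegral_indicator measurableSet_Ioc, Measure.restrict_restrict measurableSet_Ioc,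
          inter_eq_left.2 Ioc_subset_Ioi_self]
    · fun_prop (disch := assumption)
    · intro x hx
      have hx0 := hx.1.ne'
      have hx1 : 1 + x ≠ 0 := n1 x (Ioo_subset_Icc_self hx)
      have := (((hasDerivAt_id x).div ((hasDerivAt_id x).const_add 1) hx1).mul
        ((dg x).pow 2)).mul ((h.deriv x hx.1).neg.exp)
      refine HasDerivAt.congr_deriv this ?_
      simp only [Pi.mul_apply, Pi.pow_apply, Pi.div_apply, Pi.neg_apply, id, Nat.cast_ofNat]
      field_simp
      ring
    · fun_prop (disch := assumption)
    · intro x hx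
      have hx0 : 0 < x := hx.1
      have hx1 : 0 < 1 + x := by linarith
      have hE := (Real.exp_pos (-V x)).le
      have hxx : 0 ≤ x / (1 + x) ∧ x / (1 + x) ≤ 1 :=
        ⟨by positivity, by rw [div_le_one hx1]; linarith⟩
      have h1 : x / (1 + x) * (2 * g x * k' x) ≤ c / 4 * g x ^ 2 + 4 / c * k' x ^ 2 := by
        have h3 : 2 * |g x * k' x| ≤ c / 4 * g x ^ 2 + 4 / c * k' x ^ 2 := by
          have e : c / 4 * g x ^ 2 + 4 / c * k' x ^ 2 - 2 * |g x * k' x| =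
              (c / 4) * (|g x| - 4 / c * |k' x|) ^ 2 := by
            rw [sub_sq, mul_pow, sq_abs, sq_abs, abs_mul]; field_simp; ring
          nlinarith [show 0 ≤ (c / 4) * (|g x| - 4 / c * |k' x|) ^ 2 by positivity]
        have h4 : x / (1 + x) * (2 * g x * k' x) ≤ 1 * (2 * |g x * k' x|) := by
          have : 2 * g x * k' x ≤ 2 * |g x * k' x| := by
            linarith [le_abs_self (g x * k' x)]
          calc _ ≤ x / (1 + x) * (2 * |g x * k' x|) := by gcongr
            _ ≤ _ := by gcongr; exact hxx.2
        linarith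
      have hq : c - B / (1 + x) ≤ q x / (1 + x) := by
        have h5 := h.q_ge x hx0
        have h6 : (1 + x) ≤ (1 + x) ^ α := by
          conv_lhs => rw [← Real.rpow_one (1 + x)]
          exact Real.rpow_le_rpow_of_exponent_le (by linarith) hα.le
        rw [le_div_iff₀ hx1, sub_mul, div_mul_cancel₀ _ hx1.ne']
        nlinarith
      have hinv : 1 / (1 + x) ≤ 1 := by rw [div_le_one hx1]; linarith
      have hsq : 1 / (1 + x) ^ 2 ≤ 1 / (1 + x) := by
        apply one_div_le_one_div_of_le hx1; nlinarith
      have hs := sq_nonneg (g x)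
      have hBx : B / (1 + x) = B * (1 / (1 + x)) := by ring
      have h7 : (1 / (1 + x) ^ 2 - q x / (1 + x)) * g x ^ 2 ≤
          ((B + 1) * (1 / (1 + x)) - c) * g x ^ 2 := by
        gcongr ?_ * _
        linarith
      by_cases hxL : x ≤ L
      · have : x ∈ Ioc 0 L := ⟨hx0, hxL⟩
        simp only [this, indicator_of_mem]
        have h8 : ((B + 1) * (1 / (1 + x)) - c) * g x ^ 2 ≤ (B + 1 - c) * g x ^ 2 := by
          gcongr ?_ * _
          nlinarith
        have h9 : 1 / (1 + x) ^ 2 * g x ^ 2 + x / (1 + x) * (2 * g x * k' x) -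
            g x ^ 2 * (q x / (1 + x)) + c / 4 * g x ^ 2 ≤ 4 / c * k' x ^ 2 + κ * g x ^ 2 := by
          have : 0 ≤ c * g x ^ 2 := by positivity
          rw [hκ]
          linarith
        linarith [mul_le_mul_of_nonneg_left h9 hE]
      · have : x ∉ Ioc 0 L := fun hx => hxL hx.2
        simp only [this, not_false_eq_true, indicator_of_notMem, add_zero]
        have h8 : ((B + 1) * (1 / (1 + x)) - c) * g x ^ 2 ≤ (-(c / 2)) * g x ^ 2 := by
          gcongr ?_ * _
          have : (B + 1) * (1 / (1 + x)) ≤ c / 2 := by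
            rw [mul_one_div, div_le_iff₀ hx1]
            have : (2 * (B + 1) + c) / c < x := by linarith
            rw [div_lt_iff₀ hc] at this
            linarith
          linarith
        have h9 : 1 / (1 + x) ^ 2 * g x ^ 2 + x / (1 + x) * (2 * g x * k' x) -
            g x ^ 2 * (q x / (1 + x)) + c / 4 * g x ^ 2 ≤ 4 / c * k' x ^ 2 := by
          linarith
        linarith [mul_le_mul_of_nonneg_left h9 hE]
  have fin : ∫⁻ x in Ioi (0 : ℝ), ENNReal.ofReal (c / 4 * (Real.exp (-V x) * g x ^ 2)) ≤
      ENNReal.ofReal (4 / c + κ * M * (4 * L ^ 2) / m) * I := lintegral_Ioi_le_of_forall_nat main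
  calc ∫⁻ x in Ioi (0 : ℝ), ENNReal.ofReal (Real.exp (-V x) * g x ^ 2)
      = ENNReal.ofReal (4 / c) *
        ∫⁻ x in Ioi (0 : ℝ), ENNReal.ofReal (c / 4 * (Real.exp (-V x) * g x ^ 2)) := by
        rw [← lintegral_const_mul' _ _ ENNReal.ofReal_ne_top]
        refine lintegral_congr fun x => ?_
        rw [← ENNReal.ofReal_mul (by positivity)]
        congr 1
        field_simp
    _ ≤ ENNReal.ofReal (4 / c) * (ENNReal.ofReal (4 / c + κ * M * (4 * L ^ 2) / m) * I) := by
        gcongr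
    _ = ENNReal.ofReal A * I := by
        rw [← mul_assoc, ← ENNReal.ofReal_mul (by positivity)]
    _ ≤ ENNReal.ofReal (A + 1) * I := by gcongr; linarith

end HalfLinePotential

namespace HalfLinePotential

variable {α : ℝ} {V q : ℝ → ℝ} {c B K : ℝ}

/-- The function p = k² exp(-K(1+y)^α) lies below k² exp(-V), because V ≤ K(1+y)^α. Its derivative
costs k² + k'² and a multiple of (1+y)^α k², whose integral is bounded by `moment`. So p is at most
its mean over ]0, 1] plus its total variation, and undoing the exponential gives the bound. -/
theorem pointwise (h : HalfLinePotential α V q c B K) (hα : 1 < α) :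
    ∃ C : ℝ, 1 ≤ C ∧ ∀ k k' : ℝ → ℝ, (∀ x, HasDerivAt k (k' x) x) → Continuous k' →
    ∀ x, 0 < x → ENNReal.ofReal (k x ^ 2) ≤ ENNReal.ofReal (C * Real.exp (C * (1 + |x|) ^ α)) *
      ∫⁻ y, ENNReal.ofReal (k y ^ 2 + k' y ^ 2 + powEnergy α.conjExponent k k' y)
        ∂halfLineMeasure V := by
  have hK := h.K_nonneg
  obtain ⟨C, hC, hmom⟩ := h.moment hα
  -- One unit bounds the mean of p over ]0, 1]; the rest, 1 + KαC, bounds the integral of |p'|.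
  set A : ℝ := 2 + K * α * C with hA
  have hA0 : 0 ≤ K * α * C := by positivity
  refine ⟨A + K, by linarith, fun k k' hk hk' x hx => ?_⟩
  have ck : Continuous k := continuous_iff_continuousAt.2 fun x => (hk x).continuousAt
  have mV := h.meas
  have mk := ck.measurable
  have mk' := hk'.measurable
  have mD := measurable_powEnergy α.conjExponent mk mk'
  set D := powEnergy α.conjExponent k k' with hD
  have hD0 : ∀ x, 0 ≤ D x := powEnergy_nonneg α.conjExponent k k'
  set J := ∫⁻ y, ENNReal.ofReal (k y ^ 2 + k' y ^ 2 + D y) ∂halfLineMeasure V with hJ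
  have hm := hmom k k' hk hk'
  have hm2 : ∫⁻ x, ENNReal.ofReal ((1 + |x|) ^ α * k x ^ 2) ∂halfLineMeasure V ≤
      ENNReal.ofReal C * J := by
    refine hm.trans ?_
    rw [hJ]
    gcongr with y
    nlinarith [sq_nonneg (k' y)]
  -- the function `k² exp (-K (1 + x)^α)` and its derivative
  set p : ℝ → ℝ := fun y => k y ^ 2 * Real.exp (-(K * (1 + y) ^ α)) with hp
  set p' : ℝ → ℝ := fun y => (2 * k y * k' y - k y ^ 2 * (K * (α * (1 + y) ^ (α - 1)))) *
    Real.exp (-(K * (1 + y) ^ α)) with hp'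
  have dp : ∀ y, 0 < y → HasDerivAt p (p' y) y := by
    intro y hy
    have h1 : HasDerivAt (fun y : ℝ => (1 + y) ^ α) (1 * α * (1 + y) ^ (α - 1)) y :=
      ((hasDerivAt_id y).const_add 1).rpow_const (Or.inr hα.le)
    refine HasDerivAt.congr_deriv (((hk y).pow 2).mul ((h1.const_mul K).neg.exp)) ?_
    simp only [Pi.pow_apply, Pi.neg_apply, Nat.cast_ofNat, hp']
    ring
  have cp' : ContinuousOn p' (Ici 0) := by
    have h1 : ContinuousOn (fun y : ℝ => (1 + y) ^ (α - 1)) (Ici 0) :=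
      ((continuous_const.add continuous_id).rpow_const
        fun x => Or.inr (by linarith)).continuousOn
    have h2 : ContinuousOn (fun y : ℝ => (1 + y) ^ α) (Ici 0) :=
      ((continuous_const.add continuous_id).rpow_const
        fun x => Or.inr (by linarith)).continuousOn
    fun_prop
  have hexp : ∀ y, 0 < y → Real.exp (-(K * (1 + y) ^ α)) ≤ Real.exp (-V y) := fun y hy =>
    Real.exp_le_exp.2 (neg_le_neg (h.V_le y hy))
  have p_le : ∫⁻ y in Ioi (0 : ℝ), ENNReal.ofReal (p y) ≤ J := by
    rw [hJ, lintegral_halfLineMeasure mV]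
    refine setLIntegral_mono' measurableSet_Ioi fun y hy => ENNReal.ofReal_le_ofReal ?_
    have h1 := hexp y hy
    have h2 := hD0 y
    calc p y = Real.exp (-(K * (1 + y) ^ α)) * k y ^ 2 := mul_comm _ _
      _ ≤ _ := by
        gcongr
        nlinarith [sq_nonneg (k' y)]
  have p'_le : ∫⁻ y in Ioi (0 : ℝ), ENNReal.ofReal |p' y| ≤ ENNReal.ofReal (1 + K * α * C) * J := by
    have h1 : ∀ y ∈ Ioi (0 : ℝ), ENNReal.ofReal |p' y| ≤
        ENNReal.ofReal (Real.exp (-V y) * (k y ^ 2 + k' y ^ 2 + D y)) +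
        ENNReal.ofReal (K * α) * ENNReal.ofReal (Real.exp (-V y) * ((1 + |y|) ^ α * k y ^ 2)) := by
      intro y hy
      have hy0 : (0 : ℝ) < y := hy
      have := hD0 y
      rw [← ENNReal.ofReal_mul (by positivity), ← ENNReal.ofReal_add (by positivity)
        (by positivity)]
      refine ENNReal.ofReal_le_ofReal ?_
      rw [hp', abs_mul, abs_of_pos (Real.exp_pos _), abs_of_pos hy0]
      have h2 : (1 + y) ^ (α - 1) ≤ (1 + y) ^ α :=
        Real.rpow_le_rpow_of_exponent_le (by linarith) (by linarith)
      have h3 : |2 * k y * k' y - k y ^ 2 * (K * (α * (1 + y) ^ (α - 1)))| ≤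
          k y ^ 2 + k' y ^ 2 + D y + K * α * ((1 + y) ^ α * k y ^ 2) := by
        have h4 : 0 ≤ k y ^ 2 * (K * (α * (1 + y) ^ (α - 1))) := by positivity
        have h5 : k y ^ 2 * (K * (α * (1 + y) ^ (α - 1))) ≤ K * α * ((1 + y) ^ α * k y ^ 2) := by
          calc _ = K * α * ((1 + y) ^ (α - 1) * k y ^ 2) := by ring
            _ ≤ _ := by gcongr
        rw [abs_le]
        constructor <;> nlinarith [sq_nonneg (k y - k' y), sq_nonneg (k y + k' y)]
      calc _ ≤ (k y ^ 2 + k' y ^ 2 + D y + K * α * ((1 + y) ^ α * k y ^ 2)) *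
            Real.exp (-V y) := by
            have := hexp y hy0
            gcongr
        _ = _ := by ring
    refine (setLIntegral_mono' measurableSet_Ioi h1).trans ?_
    rw [lintegral_add_left (by fun_prop), lintegral_const_mul' _ _ ENNReal.ofReal_ne_top,
      ← lintegral_halfLineMeasure mV, ← lintegral_halfLineMeasure mV, ← hJ,
      ENNReal.ofReal_add zero_le_one hA0, add_mul, ENNReal.ofReal_one, one_mul,
      ENNReal.ofReal_mul (by positivity) (q := C), mul_assoc (ENNReal.ofReal _)]
    gcongr
  have osc : ∀ y, 0 < y → ENNReal.ofReal (p x) ≤ ENNReal.ofReal (p y) +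
      ∫⁻ y in Ioi (0 : ℝ), ENNReal.ofReal |p' y| := by
    intro y hy
    have hsub : uIcc y x ⊆ Ioi 0 := fun z hz => lt_of_lt_of_le (lt_min hy hx) hz.1
    have hI : IntervalIntegrable p' volume y x :=
      (cp'.mono (hsub.trans Ioi_subset_Ici_self)).intervalIntegrable
    have h1 := intervalIntegral.integral_eq_sub_of_hasDerivAt
      (fun z hz => dp z (hsub hz)) hI
    have h2 : p x ≤ p y + ∫ z in uIoc y x, |p' z| := by
      have := intervalIntegral.norm_integral_le_integral_norm_uIoc (f := p') (a := y) (b := x)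
        (μ := volume)
      rw [h1] at this
      simp only [Real.norm_eq_abs] at this
      linarith [le_abs_self (p x - p y)]
    refine (ENNReal.ofReal_le_ofReal h2).trans (ENNReal.ofReal_add_le.trans ?_)
    gcongr
    refine (ofReal_integral_le_lintegral hI.def'.abs).trans (lintegral_mono_set ?_)
    exact uIoc_subset_uIcc.trans hsub
  have avg : ENNReal.ofReal (p x) ≤ ENNReal.ofReal A * J := by
    calc ENNReal.ofReal (p x) = ∫⁻ y in Ioc (0 : ℝ) 1, ENNReal.ofReal (p x) := by simp
      _ ≤ ∫⁻ y in Ioc (0 : ℝ) 1, (ENNReal.ofReal (p y) +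
          ∫⁻ y in Ioi (0 : ℝ), ENNReal.ofReal |p' y|) :=
          setLIntegral_mono' measurableSet_Ioc fun y hy => osc y hy.1
      _ = (∫⁻ y in Ioc (0 : ℝ) 1, ENNReal.ofReal (p y)) +
          ∫⁻ y in Ioi (0 : ℝ), ENNReal.ofReal |p' y| := by
          rw [lintegral_add_right _ measurable_const]
          simp
      _ ≤ J + ENNReal.ofReal (1 + K * α * C) * J :=
          add_le_add ((lintegral_mono_set Ioc_subset_Ioi_self).trans p_le) p'_le
      _ = ENNReal.ofReal A * J := by
          rw [show A = 1 + (1 + K * α * C) by rw [hA]; ring,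
            ENNReal.ofReal_add (q := 1 + K * α * C) zero_le_one (by positivity), add_mul,
            ENNReal.ofReal_one, one_mul]
  have hpx : k x ^ 2 = Real.exp (K * (1 + x) ^ α) * p x := by
    rw [hp]
    simp only
    rw [mul_left_comm, ← Real.exp_add]
    simp
  rw [hpx, ENNReal.ofReal_mul (Real.exp_pos _).le]
  calc _ ≤ ENNReal.ofReal (Real.exp (K * (1 + x) ^ α)) * (ENNReal.ofReal A * J) := by gcongr
    _ = ENNReal.ofReal (A * Real.exp (K * (1 + x) ^ α)) * J := by
        rw [← mul_assoc, ← ENNReal.ofReal_mul (Real.exp_pos _).le, mul_comm A]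
    _ ≤ _ := by
        rw [abs_of_pos hx]
        have : 0 ≤ A := by linarith
        gcongr <;> linarith

theorem weightedBounds (h : HalfLinePotential α V q c B K) (hα : 1 < α) :
    ∃ C, WeightedBounds α (halfLineMeasure V) C := by
  obtain ⟨C₁, h1, H1⟩ := h.hardy hα
  obtain ⟨C₂, h2, H2⟩ := h.moment hα
  obtain ⟨C₃, h3, H3⟩ := h.pointwise hα
  refine ⟨C₁ + C₂ + C₃, by linarith, fun k k' hk hk' => (H1 k k' hk hk').trans ?_,
    fun k k' hk hk' => (H2 k k' hk hk').trans ?_, fun k k' hk hk' => ?_⟩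
  · gcongr; linarith
  · gcongr; linarith
  · have hac : halfLineMeasure V ≪ volume.restrict (Ioi 0) := withDensity_absolutelyContinuous _ _
    refine hac.ae_le ?_
    filter_upwards [ae_restrict_mem measurableSet_Ioi] with x hx
    refine (H3 k k' hk hk' x hx).trans ?_
    have : 0 ≤ (1 + |x|) ^ α := by positivity
    gcongr <;> linarith

end HalfLinePotential

/-! ### Stability of the estimates under sums, scaling and reflection. -/

namespace WeightedBounds

variable {α C₁ C₂ : ℝ} {μ ν : Measure ℝ}

/-- Hardy's inequality is centred at k(0) rather than at a mean, so both measures share the same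
centre and the bounds simply add. -/
theorem add (h₁ : WeightedBounds α μ C₁) (h₂ : WeightedBounds α ν C₂) :
    WeightedBounds α (μ + ν) (C₁ + C₂) := by
  have o1 := h₁.one_le
  have o2 := h₂.one_le
  have i1 : ENNReal.ofReal C₁ ≤ ENNReal.ofReal (C₁ + C₂) :=
    ENNReal.ofReal_le_ofReal (by linarith)
  have i2 : ENNReal.ofReal C₂ ≤ ENNReal.ofReal (C₁ + C₂) :=
    ENNReal.ofReal_le_ofReal (by linarith)
  refine ⟨by linarith, fun k k' hk hk' => ?_, fun k k' hk hk' => ?_, fun k k' hk hk' => ?_⟩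
  · rw [lintegral_add_measure, lintegral_add_measure, mul_add]
    exact add_le_add ((h₁.hardy k k' hk hk').trans (by gcongr))
      ((h₂.hardy k k' hk hk').trans (by gcongr))
  · rw [lintegral_add_measure, lintegral_add_measure, mul_add]
    exact add_le_add ((h₁.moment k k' hk hk').trans (by gcongr))
      ((h₂.moment k k' hk hk').trans (by gcongr))
  · rw [ae_add_measure_iff, lintegral_add_measure]
    constructor
    · filter_upwards [h₁.pointwise k k' hk hk'] with x hx
      refine hx.trans (mul_le_mul' (ENNReal.ofReal_le_ofReal ?_) le_self_add)
      have : 0 ≤ (1 + |x|) ^ α := by positivity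
      gcongr <;> linarith
    · filter_upwards [h₂.pointwise k k' hk hk'] with x hx
      refine hx.trans (mul_le_mul' (ENNReal.ofReal_le_ofReal ?_) le_add_self)
      have : 0 ≤ (1 + |x|) ^ α := by positivity
      gcongr <;> linarith

/-- Only the pointwise bound is not homogeneous in the measure; it accounts for the term C₁/r. -/
theorem smul (h : WeightedBounds α μ C₁) {r : ℝ} (hr : 0 < r) :
    WeightedBounds α (ENNReal.ofReal r • μ) (C₁ + C₁ / r) := by
  have o1 := h.one_le
  have : 0 < C₁ / r := by positivity
  refine ⟨by linarith, fun k k' hk hk' => ?_, fun k k' hk hk' => ?_, fun k k' hk hk' => ?_⟩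
  · rw [lintegral_smul_measure, lintegral_smul_measure, smul_eq_mul, smul_eq_mul, mul_left_comm]
    gcongr
    refine (h.hardy k k' hk hk').trans ?_
    gcongr
    linarith
  · rw [lintegral_smul_measure, lintegral_smul_measure, smul_eq_mul, smul_eq_mul, mul_left_comm]
    gcongr
    refine (h.moment k k' hk hk').trans ?_
    gcongr
    linarith
  · refine (Measure.smul_absolutelyContinuous (c := ENNReal.ofReal r)).ae_le ?_
    filter_upwards [h.pointwise k k' hk hk'] with x hx
    refine hx.trans ?_
    have hT : 0 ≤ (1 + |x|) ^ α := by positivity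
    rw [lintegral_smul_measure, smul_eq_mul, ← mul_assoc, ← ENNReal.ofReal_mul (by positivity)]
    refine mul_le_mul' (ENNReal.ofReal_le_ofReal ?_) le_rfl
    calc C₁ * Real.exp (C₁ * (1 + |x|) ^ α) = C₁ / r * Real.exp (C₁ * (1 + |x|) ^ α) * r := by
          field_simp
      _ ≤ _ := by gcongr <;> linarith

theorem map_neg (h : WeightedBounds α μ C₁) :
    WeightedBounds α (μ.map fun x => -x) C₁ := by
  have me : MeasurableEmbedding fun x : ℝ => -x := (Homeomorph.neg ℝ).measurableEmbedding
  have hd : ∀ k k' : ℝ → ℝ, (∀ x, HasDerivAt k (k' x) x) →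
      ∀ x, HasDerivAt (fun x => k (-x)) (-k' (-x)) x := by
    intro k k' hk x
    have := (hk (-x)).comp x (hasDerivAt_neg x)
    simpa [Function.comp_def] using this
  refine ⟨h.one_le, fun k k' hk hk' => ?_, fun k k' hk hk' => ?_, fun k k' hk hk' => ?_⟩
  · have := h.hardy _ _ (hd k k' hk) (by fun_prop)
    rw [me.lintegral_map, me.lintegral_map]
    simpa using this
  · have := h.moment _ _ (hd k k' hk) (by fun_prop)
    rw [me.lintegral_map, me.lintegral_map]
    simpa [powEnergy, neg_div] using this
  · have := h.pointwise _ _ (hd k k' hk) (by fun_prop)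
    rw [me.ae_map_iff, me.lintegral_map]
    simpa [powEnergy, neg_div] using this

end WeightedBounds

/-- A zero of f with nonzero derivative is isolated, so such zeros are countable. This is needed
because f'² is counted in `totalEnergy` at zeros of f, whereas `energy` ignores them. -/
theorem ae_deriv_eq_zero_of_eq_zero {f f' : ℝ → ℝ} (hf : ∀ x, HasDerivAt f (f' x) x) :
    ∀ᵐ x, f x = 0 → f' x = 0 := by
  set s : Set ℝ := {x | f x = 0 ∧ f' x ≠ 0} with hs
  have hcount : s.Countable := by
    refine Set.Countable.mono (fun x hx => ?_) (countable_setOfPred_isolated_right_within (s := s))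
    refine ⟨hx, ?_⟩
    have h := (hf x).eventually_ne (c := 0) hx.2
    rw [← Filter.empty_mem_iff_bot]
    have h1 : {z | f z ≠ 0} ∈ nhdsWithin x (s ∩ Ioi x) :=
      nhdsWithin_mono x (fun z hz => ne_of_gt hz.2) h
    filter_upwards [h1, self_mem_nhdsWithin] with z hz hz'
    exact hz hz'.1.1
  filter_upwards [hcount.ae_notMem volume] with x hx h0
  by_contra h1
  exact hx ⟨h0, h1⟩

/-! ### A truncation which vanishes on `[-1, 1]` and is comparable to the identity at infinity -/

/-- `max 0 ((s² - 1) / (s² + 1))`. -/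
noncomputable def cutRatio (s : ℝ) : ℝ := max 0 ((s ^ 2 - 1) / (s ^ 2 + 1))

/-- The truncation `s ↦ s r(s)^n`, `r = cutRatio`. -/
noncomputable def cut (n : ℕ) (s : ℝ) : ℝ := s * cutRatio s ^ n

/-- The derivative of `cut n`. -/
noncomputable def cutDeriv (n : ℕ) (s : ℝ) : ℝ :=
  cutRatio s ^ n + n * cutRatio s ^ (n - 1) * (4 * s ^ 2 / (s ^ 2 + 1) ^ 2)

theorem cutRatio_nonneg (s : ℝ) : 0 ≤ cutRatio s := le_max_left _ _

theorem cutRatio_le_one (s : ℝ) : cutRatio s ≤ 1 := by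
  refine max_le zero_le_one ?_
  rw [div_le_one (by positivity)]
  linarith

theorem continuous_cutRatio : Continuous cutRatio := by
  unfold cutRatio
  refine continuous_const.max (Continuous.div (by fun_prop) (by fun_prop) fun s => by positivity)

theorem hasDerivAt_max_zero_pow {n : ℕ} (hn : 2 ≤ n) (y : ℝ) :
    HasDerivAt (fun y : ℝ => max 0 y ^ n) (n * max 0 y ^ (n - 1)) y := by
  have hne : ∀ y : ℝ, y ≠ 0 →
      HasDerivAt (fun y : ℝ => max 0 y ^ n) (n * max 0 y ^ (n - 1)) y := by
    intro y hy
    rcases lt_or_gt_of_ne hy with h | h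
    · rw [max_eq_left h.le, zero_pow (by omega), mul_zero]
      refine (hasDerivAt_const y (0 : ℝ)).congr_of_eventuallyEq ?_
      filter_upwards [gt_mem_nhds h] with z hz
      rw [max_eq_left hz.le, zero_pow (by omega)]
    · rw [max_eq_right h.le]
      refine (hasDerivAt_pow n y).congr_of_eventuallyEq ?_
      filter_upwards [lt_mem_nhds h] with z hz
      rw [max_eq_right hz.le]
  by_cases hy : y = 0
  · subst hy
    exact hasDerivAt_of_hasDerivAt_of_ne hne (by fun_prop)
      (g := fun y : ℝ => (n : ℝ) * max 0 y ^ (n - 1)) (by fun_prop)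
  · exact hne y hy

theorem hasDerivAt_cut {n : ℕ} (hn : 2 ≤ n) (s : ℝ) : HasDerivAt (cut n) (cutDeriv n s) s := by
  have hpos : s ^ 2 + 1 ≠ 0 := by positivity
  have h1 : HasDerivAt (fun s : ℝ => (s ^ 2 - 1) / (s ^ 2 + 1)) (4 * s / (s ^ 2 + 1) ^ 2) s := by
    refine HasDerivAt.congr_deriv (((hasDerivAt_pow 2 s).sub_const 1).div
      ((hasDerivAt_pow 2 s).add_const 1) hpos) ?_
    congr 1
    push_cast
    ring
  have h2 := (hasDerivAt_max_zero_pow hn ((s ^ 2 - 1) / (s ^ 2 + 1))).comp s h1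
  refine HasDerivAt.congr_deriv ((hasDerivAt_id s).mul h2) ?_
  simp only [cutDeriv, cutRatio, id]
  ring

theorem continuous_cutDeriv (n : ℕ) : Continuous (cutDeriv n) := by
  have := continuous_cutRatio
  unfold cutDeriv
  have h : Continuous fun s : ℝ => 4 * s ^ 2 / (s ^ 2 + 1) ^ 2 :=
    Continuous.div (by fun_prop) (by fun_prop) fun s => by positivity
  fun_prop

theorem abs_cutDeriv_le {n : ℕ} (hn : 1 ≤ n) (s : ℝ) :
    |cutDeriv n s| ≤ (1 + n) * cutRatio s ^ (n - 1) := by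
  have h0 := cutRatio_nonneg s
  have h1 := cutRatio_le_one s
  have h2 : 4 * s ^ 2 / (s ^ 2 + 1) ^ 2 ≤ 1 := by
    rw [div_le_one (by positivity)]
    nlinarith [sq_nonneg (s ^ 2 - 1)]
  have h3 : cutRatio s ^ n ≤ cutRatio s ^ (n - 1) := pow_le_pow_of_le_one h0 h1 (by omega)
  have h4 : (n : ℝ) * cutRatio s ^ (n - 1) * (4 * s ^ 2 / (s ^ 2 + 1) ^ 2) ≤
      n * cutRatio s ^ (n - 1) * 1 := by gcongr
  unfold cutDeriv
  rw [abs_of_nonneg (by positivity)]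
  linarith

/-- The numerator s² - 1 of the ratio supplies the factor s - 1, and |s||s+1| ≤ 2(s²+1). -/
theorem cut_sq_le {n : ℕ} (hn : 1 ≤ n) (s : ℝ) : cut n s ^ 2 ≤ 4 * (s - 1) ^ 2 := by
  have h0 := cutRatio_nonneg s
  have h1 := cutRatio_le_one s
  have h3 : cutRatio s ^ n ≤ cutRatio s := pow_le_of_le_one h0 h1 (by omega)
  have h4 : |s| * cutRatio s ≤ 2 * |s - 1| := by
    unfold cutRatio
    rw [mul_max_of_nonneg _ _ (abs_nonneg s), mul_zero]
    refine max_le (by positivity) ?_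
    rw [mul_div_assoc', div_le_iff₀ (by positivity)]
    have e : |s| * (s ^ 2 - 1) ≤ |s - 1| * (|s| * |s + 1|) := by
      calc |s| * (s ^ 2 - 1) ≤ |s| * |s ^ 2 - 1| := by gcongr; exact le_abs_self _
        _ = _ := by rw [show s ^ 2 - 1 = (s - 1) * (s + 1) by ring, abs_mul]; ring
    have h5 : |s| * |s + 1| ≤ 2 * (s ^ 2 + 1) := by
      rw [← abs_mul, abs_le]
      constructor <;> nlinarith [sq_nonneg (s - 1), sq_nonneg (s + 1)]
    calc _ ≤ _ := e
      _ ≤ |s - 1| * (2 * (s ^ 2 + 1)) := by gcongr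
      _ = _ := by ring
  have h5 : |cut n s| ≤ 2 * |s - 1| := by
    unfold cut
    rw [abs_mul, abs_of_nonneg (show 0 ≤ cutRatio s ^ n by positivity)]
    exact le_trans (by gcongr) h4
  calc cut n s ^ 2 = |cut n s| ^ 2 := (sq_abs _).symm
    _ ≤ (2 * |s - 1|) ^ 2 := by gcongr
    _ = _ := by rw [mul_pow, sq_abs]; ring

/-- With r = `cutRatio`, the logarithmic derivative of the truncation grows at most like
(1+n)|g'/g|/r, while its square is g² r^(2n). The power left over is r^(2n-β) ≤ 1, which is why n
must be at least β/2. -/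
theorem powEnergy_cut_le {β : ℝ} (hβ : 0 < β) {n : ℕ} (hn : 1 ≤ n) (hnβ : β ≤ 2 * n)
    (g g' : ℝ → ℝ) (x : ℝ) :
    powEnergy β (fun x => cut n (g x)) (fun x => cutDeriv n (g x) * g' x) x ≤
      (1 + n) ^ β * powEnergy β g g' x := by
  unfold powEnergy
  simp only
  by_cases hc : cut n (g x) = 0
  · rw [hc]
    simp only [ne_eq, OfNat.ofNat_ne_zero, not_false_eq_true, zero_pow, mul_zero]
    positivity
  · have hg : g x ≠ 0 := fun h => hc (by simp [cut, h])
    have hr0 : cutRatio (g x) ≠ 0 := fun h => hc (by simp [cut, h, show n ≠ 0 by omega])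
    have hr : 0 < cutRatio (g x) := lt_of_le_of_ne (cutRatio_nonneg _) (Ne.symm hr0)
    have hr1 := cutRatio_le_one (g x)
    have hd := abs_cutDeriv_le hn (g x)
    set r := cutRatio (g x) with hrdef
    have h1 : |cutDeriv n (g x) * g' x / cut n (g x)| ≤ (1 + n) * |g' x / g x| / r := by
      have : cut n (g x) = g x * (r ^ (n - 1) * r) := by
        rw [← pow_succ, Nat.sub_add_cancel hn, cut]
      rw [this, abs_div, abs_mul, abs_mul, abs_of_nonneg (show 0 ≤ r ^ (n - 1) * r by positivity),
        abs_div]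
      have hg' : 0 < |g x| := abs_pos.2 hg
      rw [div_le_iff₀ (by positivity)]
      calc _ ≤ (1 + n) * r ^ (n - 1) * |g' x| := by gcongr
        _ = _ := by field_simp
    have h2 : cut n (g x) ^ 2 = g x ^ 2 * r ^ ((2 * n : ℕ) : ℝ) := by
      rw [Real.rpow_natCast, cut, mul_pow, ← pow_mul, mul_comm n 2]
    calc _ ≤ ((1 + n) * |g' x / g x| / r) ^ β * (g x ^ 2 * r ^ ((2 * n : ℕ) : ℝ)) := by
          rw [h2]; gcongr
      _ = (1 + n) ^ β * (|g' x / g x| ^ β * g x ^ 2) * r ^ (((2 * n : ℕ) : ℝ) - β) := by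
          rw [Real.div_rpow (by positivity) hr.le, Real.mul_rpow (by positivity) (abs_nonneg _),
            Real.rpow_sub hr]
          ring
      _ ≤ (1 + n) ^ β * (|g' x / g x| ^ β * g x ^ 2) * 1 := by
          gcongr
          refine Real.rpow_le_one hr.le hr1 ?_
          push_cast
          linarith
      _ = _ := mul_one _

/-- For |s| ≥ 4^n the ratio is at least 1/2, so s² ≤ 4^n cut² and even |s| ≤ cut², whence log s² ≤ 2
log cut² ≤ 2L. For |s| < 4^n, log s² ≤ s² - 1 bounds the left side by (s² - 1)². -/
theorem mul_log_sub_add_one_le {n : ℕ} (hn : 1 ≤ n) {s L : ℝ} (hL0 : 0 ≤ L)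
    (hL : Real.log (cut n s ^ 2) ≤ L) :
    s ^ 2 * Real.log (s ^ 2) - s ^ 2 + 1 ≤
      (4 ^ n + 1) ^ 2 * (s - 1) ^ 2 + 2 * 4 ^ n * (cut n s ^ 2 * L) := by
  by_cases hs : (4 : ℝ) ^ n ≤ |s|
  · have h4 : (4 : ℝ) ≤ 4 ^ n := by
      calc (4 : ℝ) = 4 ^ 1 := by norm_num
        _ ≤ _ := pow_le_pow_right₀ (by norm_num) hn
    have hs2 : 2 ≤ |s| := by linarith
    have hsq : 4 ≤ s ^ 2 := by rw [← sq_abs]; nlinarith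
    have hr : 1 / 2 ≤ cutRatio s := by
      refine le_max_of_le_right ?_
      rw [div_le_div_iff₀ (by norm_num) (by positivity)]
      linarith
    have h5 : s ^ 2 ≤ 4 ^ n * cut n s ^ 2 := by
      have h6 : (1 / 2 : ℝ) ^ (n * 2) ≤ cutRatio s ^ (n * 2) := by gcongr
      have h7 : (4 : ℝ) ^ n * (1 / 2) ^ (n * 2) = 1 := by
        rw [pow_mul', ← mul_pow]; norm_num
      rw [cut, mul_pow, ← pow_mul]
      calc s ^ 2 = s ^ 2 * (4 ^ n * (1 / 2) ^ (n * 2)) := by rw [h7, mul_one]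
        _ ≤ s ^ 2 * (4 ^ n * cutRatio s ^ (n * 2)) := by gcongr
        _ = _ := by ring
    have h6 : |s| ≤ cut n s ^ 2 := by
      have : (4 : ℝ) ^ n * |s| ≤ 4 ^ n * cut n s ^ 2 := by
        refine le_trans ?_ h5
        rw [← sq_abs]
        nlinarith
      exact le_of_mul_le_mul_left this (by positivity)
    have h7 : Real.log (s ^ 2) ≤ 2 * L := by
      rw [← sq_abs, Real.log_pow]
      have := Real.log_le_log (by linarith) h6
      push_cast
      linarith
    have h8 : s ^ 2 * Real.log (s ^ 2) ≤ 4 ^ n * cut n s ^ 2 * (2 * L) := by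
      calc _ ≤ s ^ 2 * (2 * L) := by gcongr
        _ ≤ _ := by gcongr
    have : 0 ≤ ((4 : ℝ) ^ n + 1) ^ 2 * (s - 1) ^ 2 := by positivity
    linarith
  · push Not at hs
    have h1 : s ^ 2 * Real.log (s ^ 2) - s ^ 2 + 1 ≤ (s ^ 2 - 1) ^ 2 := by
      by_cases h0 : s = 0
      · simp [h0]
      · have := Real.log_le_sub_one_of_pos (show 0 < s ^ 2 by positivity)
        nlinarith [mul_le_mul_of_nonneg_left this (sq_nonneg s)]
    have h2 : (s ^ 2 - 1) ^ 2 ≤ (4 ^ n + 1) ^ 2 * (s - 1) ^ 2 := by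
      have : (s + 1) ^ 2 ≤ (4 ^ n + 1) ^ 2 := by
        rw [sq_le_sq, abs_of_nonneg (show (0 : ℝ) ≤ 4 ^ n + 1 by positivity)]
        exact (abs_add_le s 1).trans (by rw [abs_one]; linarith)
      calc (s ^ 2 - 1) ^ 2 = (s + 1) ^ 2 * (s - 1) ^ 2 := by ring
        _ ≤ _ := by gcongr
    have : 0 ≤ 2 * 4 ^ n * (cut n s ^ 2 * L) := by positivity
    linarith

/-! ### From the three estimates to a bound of the entropy by the total energy. -/

theorem integrable_of_lintegral_ofReal_le {μ : Measure ℝ} {F : ℝ → ℝ} (hF : Measurable F)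
    (h0 : ∀ x, 0 ≤ F x) {A : ℝ} (hA : 0 ≤ A)
    (h : ∫⁻ x, ENNReal.ofReal (F x) ∂μ ≤ ENNReal.ofReal A) :
    Integrable F μ ∧ ∫ x, F x ∂μ ≤ A := by
  refine ⟨⟨hF.aestronglyMeasurable, ?_⟩, ?_⟩
  · rw [hasFiniteIntegral_iff_ofReal (Filter.Eventually.of_forall h0)]
    exact h.trans_lt ENNReal.ofReal_lt_top
  · rw [integral_eq_lintegral_of_nonneg_ae (Filter.Eventually.of_forall h0)
      hF.aestronglyMeasurable]
    exact (ENNReal.toReal_mono ENNReal.ofReal_ne_top h).trans_eq (ENNReal.toReal_ofReal hA)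

theorem integrable_of_le_of_le {μ : Measure ℝ} {l F G : ℝ → ℝ} (hF : Measurable F)
    (hl : Integrable l μ) (hG : Integrable G μ) (h₁ : ∀ x, l x ≤ F x)
    (h₂ : ∀ᵐ x ∂μ, F x ≤ G x) : Integrable F μ ∧ ∫ x, F x ∂μ ≤ ∫ x, G x ∂μ := by
  have hi : Integrable F μ := by
    refine (hl.abs.add hG.abs).mono' hF.aestronglyMeasurable ?_
    filter_upwards [h₂] with x hx
    have := h₁ x
    rw [Real.norm_eq_abs, Pi.add_apply]
    rw [abs_le]
    constructor
    · linarith [neg_abs_le (l x), abs_nonneg (G x)]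
    · linarith [le_abs_self (G x), abs_nonneg (l x)]
  exact ⟨hi, integral_mono_ae hi hG h₂⟩

/-- The integral of `k'² + |k'/k|^β k²`. -/
noncomputable def totalEnergy (α : ℝ) (μ : Measure ℝ) (k k' : ℝ → ℝ) : ℝ≥0∞ :=
  ∫⁻ x, ENNReal.ofReal (k' x ^ 2 + powEnergy α.conjExponent k k' x) ∂μ

namespace WeightedBounds

variable {α C : ℝ} {μ : Measure ℝ}

theorem integral_sub_sq_le (h : WeightedBounds α μ C) {k k' : ℝ → ℝ}
    (hk : ∀ x, HasDerivAt k (k' x) x) (hk' : Continuous k') (hE : totalEnergy α μ k k' ≠ ⊤) :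
    Integrable (fun x => (k x - k 0) ^ 2) μ ∧
      ∫ x, (k x - k 0) ^ 2 ∂μ ≤ C * (totalEnergy α μ k k').toReal := by
  have ck : Continuous k := continuous_iff_continuousAt.2 fun x => (hk x).continuousAt
  have hC := h.one_le
  refine integrable_of_lintegral_ofReal_le (by fun_prop) (fun x => sq_nonneg _) (by positivity) ?_
  refine (h.hardy k k' hk hk').trans ?_
  rw [ENNReal.ofReal_mul (by linarith), ENNReal.ofReal_toReal hE]
  gcongr
  exact lintegral_mono fun x => ENNReal.ofReal_le_ofReal
    (le_add_of_nonneg_right (powEnergy_nonneg _ _ _ _))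

theorem integral_rpow_mul_sq_le (h : WeightedBounds α μ C) (hα : 1 < α) {k k' : ℝ → ℝ}
    (hk : ∀ x, HasDerivAt k (k' x) x) (hk' : Continuous k') (hE : totalEnergy α μ k k' ≠ ⊤)
    (hk2 : Integrable (fun x => k x ^ 2) μ) :
    Integrable (fun x => (1 + |x|) ^ α * k x ^ 2) μ ∧
      ∫ x, (1 + |x|) ^ α * k x ^ 2 ∂μ ≤
        C * (∫ x, k x ^ 2 ∂μ + (totalEnergy α μ k k').toReal) := by
  have ck : Continuous k := continuous_iff_continuousAt.2 fun x => (hk x).continuousAt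
  have hC := h.one_le
  have hN : 0 ≤ ∫ x, k x ^ 2 ∂μ := integral_nonneg fun x => sq_nonneg _
  have cT : Continuous fun x : ℝ => (1 + |x|) ^ α :=
    (continuous_const.add continuous_abs).rpow_const fun x => Or.inr (by linarith)
  refine integrable_of_lintegral_ofReal_le (by fun_prop) (fun x => by positivity)
    (by positivity) ?_
  refine (h.moment k k' hk hk').trans ?_
  rw [ENNReal.ofReal_mul (by linarith), ENNReal.ofReal_add hN ENNReal.toReal_nonneg,
    ENNReal.ofReal_toReal hE,
    ofReal_integral_eq_lintegral_ofReal hk2 (Filter.Eventually.of_forall fun x => sq_nonneg _)]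
  gcongr
  rw [totalEnergy, ← lintegral_add_left (by fun_prop)]
  refine lintegral_mono fun x => ?_
  rw [← ENNReal.ofReal_add (sq_nonneg _) (add_nonneg (sq_nonneg _) (powEnergy_nonneg _ _ _ _))]
  exact ENNReal.ofReal_le_ofReal (by nlinarith [sq_nonneg (k' x)])

/-- Take logarithms in the pointwise bound and use log t ≤ t - 1 for the constant and for ∫ k² +
E(k). Where k vanishes, `Real.log 0 = 0` and the right side is nonnegative. -/
theorem log_sq_le (h : WeightedBounds α μ C) {k k' : ℝ → ℝ}
    (hk : ∀ x, HasDerivAt k (k' x) x) (hk' : Continuous k') (hE : totalEnergy α μ k k' ≠ ⊤)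
    (hk2 : Integrable (fun x => k x ^ 2) μ) :
    ∀ᵐ x ∂μ, Real.log (k x ^ 2) ≤
      C + C * (1 + |x|) ^ α + (∫ x, k x ^ 2 ∂μ + (totalEnergy α μ k k').toReal) := by
  have ck : Continuous k := continuous_iff_continuousAt.2 fun x => (hk x).continuousAt
  have hC := h.one_le
  have hN : 0 ≤ ∫ x, k x ^ 2 ∂μ := integral_nonneg fun x => sq_nonneg _
  set Q := ∫ x, k x ^ 2 ∂μ + (totalEnergy α μ k k').toReal with hQ
  have hQ0 : 0 ≤ Q := add_nonneg hN ENNReal.toReal_nonneg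
  have hint : ∫⁻ y, ENNReal.ofReal (k y ^ 2 + k' y ^ 2 + powEnergy α.conjExponent k k' y) ∂μ =
      ENNReal.ofReal Q := by
    rw [hQ, ENNReal.ofReal_add hN ENNReal.toReal_nonneg, ENNReal.ofReal_toReal hE,
      ofReal_integral_eq_lintegral_ofReal hk2 (Filter.Eventually.of_forall fun x => sq_nonneg _),
      totalEnergy, ← lintegral_add_left (by fun_prop)]
    refine lintegral_congr fun x => ?_
    rw [← ENNReal.ofReal_add (sq_nonneg _) (add_nonneg (sq_nonneg _) (powEnergy_nonneg _ _ _ _)),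
      add_assoc]
  filter_upwards [h.pointwise k k' hk hk'] with x hx
  rw [hint, ← ENNReal.ofReal_mul (by positivity), ENNReal.ofReal_le_ofReal_iff (by positivity)]
    at hx
  by_cases h0 : k x = 0
  · simp only [h0, ne_eq, OfNat.ofNat_ne_zero, not_false_eq_true, zero_pow, Real.log_zero]
    positivity
  · have hk0 : 0 < k x ^ 2 := by positivity
    have hQ1 : Q ≠ 0 := by
      intro h1
      rw [h1, mul_zero] at hx
      linarith
    have hQ2 : 0 < Q := lt_of_le_of_ne hQ0 (Ne.symm hQ1)
    have h1 := Real.log_le_log hk0 hx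
    rw [Real.log_mul (by positivity) hQ1, Real.log_mul (by positivity) (Real.exp_pos _).ne',
      Real.log_exp] at h1
    have h2 := Real.log_le_sub_one_of_pos hQ2
    have h3 := Real.log_le_sub_one_of_pos (show 0 < C by linarith)
    linarith

end WeightedBounds

theorem powEnergy_div_const (β : ℝ) (f f' : ℝ → ℝ) {m : ℝ} (hm : m ≠ 0) (x : ℝ) :
    powEnergy β (fun x => f x / m) (fun x => f' x / m) x = powEnergy β f f' x / m ^ 2 := by
  unfold powEnergy
  simp only
  rw [div_div_div_cancel_right₀ hm, div_pow, mul_div_assoc]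

theorem totalEnergy_div_const (α : ℝ) (μ : Measure ℝ) (f f' : ℝ → ℝ) {m : ℝ} (hm : m ≠ 0) :
    totalEnergy α μ (fun x => f x / m) (fun x => f' x / m) =
      ENNReal.ofReal (1 / m ^ 2) * totalEnergy α μ f f' := by
  unfold totalEnergy
  rw [← lintegral_const_mul' _ _ ENNReal.ofReal_ne_top]
  refine lintegral_congr fun x => ?_
  rw [powEnergy_div_const _ _ _ hm, ← ENNReal.ofReal_mul (by positivity)]
  congr 1
  ring

theorem totalEnergy_cut_le {α : ℝ} (hα : 1 < α) (μ : Measure ℝ) {n : ℕ} (hn : 1 ≤ n)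
    (hnβ : α.conjExponent ≤ 2 * n) (g g' : ℝ → ℝ) :
    totalEnergy α μ (fun x => cut n (g x)) (fun x => cutDeriv n (g x) * g' x) ≤
      ENNReal.ofReal ((1 + n) ^ 2 + (1 + n) ^ α.conjExponent) * totalEnergy α μ g g' := by
  have hβ : 0 < α.conjExponent := (Real.HolderConjugate.conjExponent hα).symm.pos
  unfold totalEnergy
  rw [← lintegral_const_mul' _ _ ENNReal.ofReal_ne_top]
  refine lintegral_mono fun x => ?_
  simp only
  rw [← ENNReal.ofReal_mul (by positivity)]
  refine ENNReal.ofReal_le_ofReal ?_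
  have h1 := powEnergy_cut_le hβ hn hnβ g g' x
  have h2 : (cutDeriv n (g x) * g' x) ^ 2 ≤ (1 + n) ^ 2 * g' x ^ 2 := by
    rw [mul_pow, ← sq_abs (cutDeriv n (g x))]
    have : |cutDeriv n (g x)| ≤ 1 + n := by
      refine (abs_cutDeriv_le hn _).trans ?_
      exact mul_le_of_le_one_right (by positivity)
        (pow_le_one₀ (cutRatio_nonneg _) (cutRatio_le_one _))
    gcongr
  have h3 := powEnergy_nonneg α.conjExponent g g' x
  have h4 : 0 ≤ (1 + (n : ℝ)) ^ α.conjExponent * g' x ^ 2 := by positivity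
  have h5 : 0 ≤ (1 + (n : ℝ)) ^ 2 * powEnergy α.conjExponent g g' x := by positivity
  linarith

/-- Supplies the integrable minorant that makes the entropy integrand integrable once it has an
integrable majorant. -/
theorem sub_le_mul_log_div {u N : ℝ} (hu : 0 ≤ u) (hN : 0 < N) :
    u - N ≤ u * Real.log (u / N) := by
  rcases hu.eq_or_lt with rfl | hu
  · simp [hN.le]
  · have h := Real.one_sub_inv_le_log_of_pos (show 0 < u / N by positivity)
    have h1 := mul_le_mul_of_nonneg_left h hu.le
    have e : u * (1 - (u / N)⁻¹) = u - N := by field_simp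
    linarith

namespace WeightedBounds

variable {α C : ℝ} {μ : Measure ℝ}

/-- Apply `log_sq_le` to f/√N, multiply by f² and integrate. The result is bounded by N, E(f) and
the moment integral, and `hle` turns every N into a multiple of E(f). -/
theorem entropy_le_of_integral_sq_le (h : WeightedBounds α μ C) [IsProbabilityMeasure μ]
    (hα : 1 < α) {f f' : ℝ → ℝ} (hf : ∀ x, HasDerivAt f (f' x) x) (hf' : Continuous f')
    (hf2 : Integrable (fun x => f x ^ 2) μ) (hE : totalEnergy α μ f f' ≠ ⊤)
    (hN : 0 < ∫ x, f x ^ 2 ∂μ)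
    (hle : ∫ x, f x ^ 2 ∂μ ≤ 4 * C * (totalEnergy α μ f f').toReal) :
    Integrable (fun x => f x ^ 2 * Real.log (f x ^ 2 / ∫ y, f y ^ 2 ∂μ)) μ ∧
      ∫ x, f x ^ 2 * Real.log (f x ^ 2 / ∫ y, f y ^ 2 ∂μ) ∂μ ≤
        (4 * C * (C + 1) + 1 + C ^ 2 * (4 * C + 1)) * (totalEnergy α μ f f').toReal := by
  have cf : Continuous f := continuous_iff_continuousAt.2 fun x => (hf x).continuousAt
  have hC := h.one_le
  obtain ⟨iT, hT⟩ := h.integral_rpow_mul_sq_le hα hf hf' hE hf2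
  set N := ∫ x, f x ^ 2 ∂μ with hNdef
  set e := (totalEnergy α μ f f').toReal with he
  have he0 : 0 ≤ e := ENNReal.toReal_nonneg
  have hs : Real.sqrt N ≠ 0 := (Real.sqrt_pos.2 hN).ne'
  have hsq : Real.sqrt N ^ 2 = N := Real.sq_sqrt hN.le
  have hEg := totalEnergy_div_const α μ f f' hs
  rw [hsq] at hEg
  have hint : ∫ x, (f x / Real.sqrt N) ^ 2 ∂μ = 1 := by
    simp_rw [div_pow, hsq]
    rw [integral_div, ← hNdef, div_self hN.ne']
  have hlog := h.log_sq_le (k := fun x => f x / Real.sqrt N) (k' := fun x => f' x / Real.sqrt N)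
    (fun x => (hf x).div_const _) (by fun_prop)
    (by rw [hEg]; exact ENNReal.mul_ne_top ENNReal.ofReal_ne_top hE)
    (by simp_rw [div_pow]; exact hf2.div_const _)
  rw [hint, hEg, ENNReal.toReal_mul, ENNReal.toReal_ofReal (by positivity), ← he] at hlog
  simp_rw [div_pow, hsq] at hlog
  have key := integrable_of_le_of_le (μ := μ) (l := fun x => f x ^ 2 - N)
    (F := fun x => f x ^ 2 * Real.log (f x ^ 2 / N))
    (G := fun x => f x ^ 2 * (C + 1 + 1 / N * e) + C * ((1 + |x|) ^ α * f x ^ 2))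
    (by fun_prop) (hf2.sub (integrable_const _)) ((hf2.mul_const _).add (iT.const_mul _))
    (fun x => sub_le_mul_log_div (sq_nonneg _) hN) ?_
  · refine ⟨key.1, key.2.trans ?_⟩
    rw [integral_add (hf2.mul_const _) (iT.const_mul _), integral_mul_const, integral_const_mul,
      ← hNdef]
    have e1 : N * (C + 1 + 1 / N * e) = N * (C + 1) + e := by field_simp
    rw [e1]
    have h1 : N * (C + 1) ≤ 4 * C * e * (C + 1) := by gcongr
    have h2 : C * ∫ x, (1 + |x|) ^ α * f x ^ 2 ∂μ ≤ C * (C * (4 * C * e + e)) := by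
      gcongr
      refine hT.trans ?_
      gcongr
    nlinarith
  · filter_upwards [hlog] with x hx
    have := mul_le_mul_of_nonneg_left hx (sq_nonneg (f x))
    linarith

/-- Here f is close in L² to the nonzero constant f(0). The logarithmic bound is applied to the
truncation of f/f(0), which vanishes where |f| ≤ |f(0)|, so that no defect proportional to ∫ f²
appears. -/
theorem exists_entropy_le_of_integral_sub_lt (h : WeightedBounds α μ C) [IsProbabilityMeasure μ]
    (hα : 1 < α) : ∃ A : ℝ, 0 ≤ A ∧ ∀ {f f' : ℝ → ℝ}, (∀ x, HasDerivAt f (f' x) x) →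
    Continuous f' → Integrable (fun x => f x ^ 2) μ → totalEnergy α μ f f' ≠ ⊤ →
    0 < ∫ x, f x ^ 2 ∂μ → ∫ x, (f x - f 0) ^ 2 ∂μ < f 0 ^ 2 →
    Integrable (fun x => f x ^ 2 * Real.log (f x ^ 2 / ∫ y, f y ^ 2 ∂μ)) μ ∧
      ∫ x, f x ^ 2 * Real.log (f x ^ 2 / ∫ y, f y ^ 2 ∂μ) ∂μ ≤
        A * (totalEnergy α μ f f').toReal := by
  have hC := h.one_le
  -- n ≥ 2 makes the truncation continuously differentiable, and n ≥ β is more than the 2n ≥ β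
  -- needed for its energy.
  obtain ⟨n, hn⟩ := exists_nat_ge (max 2 α.conjExponent)
  have hn2 : 2 ≤ n := by exact_mod_cast (le_max_left _ _).trans hn
  have hn1 : 1 ≤ n := by omega
  have hnβ : α.conjExponent ≤ 2 * n := by
    have := (le_max_right _ _).trans hn
    have : (0 : ℝ) ≤ n := n.cast_nonneg
    linarith
  set P : ℝ := (1 + n) ^ 2 + (1 + n) ^ α.conjExponent with hP
  have hP0 : 0 ≤ P := by positivity
  set A : ℝ := (4 ^ n + 1) ^ 2 * C + 2 * 4 ^ n *
    (C * (4 * C) + C * (C * (4 * C + P)) + 4 * (4 * C + P)) with hA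
  refine ⟨A, by positivity, fun {f f'} hf hf' hf2 hE hN hlt => ?_⟩
  have cf : Continuous f := continuous_iff_continuousAt.2 fun x => (hf x).continuousAt
  set N := ∫ x, f x ^ 2 ∂μ with hNdef
  set e := (totalEnergy α μ f f').toReal with he
  set m := f 0 with hm
  have hm0 : m ≠ 0 := by
    intro h0
    have := integral_nonneg (μ := μ) (f := fun x => (f x - m) ^ 2) fun x => sq_nonneg _
    rw [h0, zero_pow two_ne_zero] at hlt
    rw [h0] at this
    linarith
  have hm2 : 0 < m ^ 2 := by positivity
  -- the normalised function
  set g : ℝ → ℝ := fun x => f x / m with hg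
  set g' : ℝ → ℝ := fun x => f' x / m with hg'
  have dg : ∀ x, HasDerivAt g (g' x) x := fun x => (hf x).div_const _
  have cg : Continuous g := cf.div_const _
  have cg' : Continuous g' := hf'.div_const _
  have fg : ∀ x, f x ^ 2 = m ^ 2 * g x ^ 2 := fun x => by rw [hg]; field_simp
  have g0 : g 0 = 1 := div_self hm0
  have hEg : totalEnergy α μ g g' = ENNReal.ofReal (1 / m ^ 2) * totalEnergy α μ f f' :=
    totalEnergy_div_const α μ f f' hm0
  have hEg' : totalEnergy α μ g g' ≠ ⊤ := by
    rw [hEg]; exact ENNReal.mul_ne_top ENNReal.ofReal_ne_top hE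
  have heg : m ^ 2 * (totalEnergy α μ g g').toReal = e := by
    rw [hEg, ENNReal.toReal_mul, ENNReal.toReal_ofReal (by positivity), ← he]
    field_simp
  obtain ⟨iS, hS⟩ := h.integral_sub_sq_le dg cg' hEg'
  rw [g0] at iS hS
  set S := ∫ x, (g x - 1) ^ 2 ∂μ with hSdef
  set eg := (totalEnergy α μ g g').toReal with hegdef
  have heg0 : 0 ≤ eg := ENNReal.toReal_nonneg
  -- This is what the closeness hypothesis is for: it bounds ∫ k² by 4, so the product (Nk + ek) *
  -- Nk is linear, not quadratic, in the energy.
  have hS1 : S ≤ 1 := by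
    have e1 : ∀ x, (f x - m) ^ 2 = m ^ 2 * (g x - 1) ^ 2 := fun x => by
      rw [hg]; field_simp
    simp_rw [e1] at hlt
    rw [integral_const_mul, ← hSdef] at hlt
    nlinarith
  -- its truncation
  set k : ℝ → ℝ := fun x => cut n (g x) with hk
  set k' : ℝ → ℝ := fun x => cutDeriv n (g x) * g' x with hk'
  have dk : ∀ x, HasDerivAt k (k' x) x := fun x => (hasDerivAt_cut hn2 (g x)).comp x (dg x)
  have ck : Continuous k := continuous_iff_continuousAt.2 fun x => (dk x).continuousAt
  have ck' : Continuous k' := ((continuous_cutDeriv n).comp cg).mul cg'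
  have hEk : totalEnergy α μ k k' ≤ ENNReal.ofReal P * totalEnergy α μ g g' :=
    totalEnergy_cut_le hα μ hn1 hnβ g g'
  have hEk' : totalEnergy α μ k k' ≠ ⊤ :=
    ne_top_of_le_ne_top (ENNReal.mul_ne_top ENNReal.ofReal_ne_top hEg') hEk
  have hek : (totalEnergy α μ k k').toReal ≤ P * eg := by
    have := ENNReal.toReal_mono (ENNReal.mul_ne_top ENNReal.ofReal_ne_top hEg') hEk
    rwa [ENNReal.toReal_mul, ENNReal.toReal_ofReal hP0] at this
  have hkS : ∀ x, k x ^ 2 ≤ 4 * (g x - 1) ^ 2 := fun x => cut_sq_le hn1 (g x)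
  have ik : Integrable (fun x => k x ^ 2) μ := by
    refine (iS.const_mul 4).mono' (by fun_prop) (Filter.Eventually.of_forall fun x => ?_)
    rw [Real.norm_eq_abs, abs_of_nonneg (sq_nonneg _)]
    exact hkS x
  have hNk : ∫ x, k x ^ 2 ∂μ ≤ 4 * S := by
    rw [hSdef, ← integral_const_mul]
    exact integral_mono ik (iS.const_mul 4) hkS
  obtain ⟨iT, hT⟩ := h.integral_rpow_mul_sq_le hα dk ck' hEk' ik
  have hlog := h.log_sq_le dk ck' hEk' ik
  set Nk := ∫ x, k x ^ 2 ∂μ with hNkdef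
  have hNk0 : 0 ≤ Nk := integral_nonneg fun x => sq_nonneg _
  set ek := (totalEnergy α μ k k').toReal with hekdef
  have hek0 : 0 ≤ ek := ENNReal.toReal_nonneg
  have ikT : Integrable (fun x => (C + (Nk + ek)) * k x ^ 2 + C * ((1 + |x|) ^ α * k x ^ 2)) μ :=
    (ik.const_mul _).add (iT.const_mul C)
  have iA := (iS.const_mul ((4 ^ n + 1) ^ 2)).add (ikT.const_mul (2 * 4 ^ n))
  have iB := (hf2.mul_const (m ^ 2 / N)).sub (integrable_const (μ := μ) (m ^ 2))
  have key := integrable_of_le_of_le (μ := μ) (l := fun x => f x ^ 2 - N)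
    (F := fun x => f x ^ 2 * Real.log (f x ^ 2 / N)) (by fun_prop)
    (hf2.sub (integrable_const _)) ((iA.const_mul (m ^ 2)).add iB)
    (fun x => sub_le_mul_log_div (sq_nonneg _) hN) ?_
  · refine ⟨key.1, key.2.trans ?_⟩
    -- Error made by normalising with m² in place of N: it integrates to zero because μ has mass
    -- one.
    have eB : ∫ x, (f x ^ 2 * (m ^ 2 / N) - m ^ 2) ∂μ = 0 := by
      rw [integral_sub (hf2.mul_const _) (integrable_const _), integral_mul_const, ← hNdef]
      simp only [integral_const, probReal_univ, one_smul]
      field_simp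
      ring
    have eA : ∫ x, ((4 ^ n + 1) ^ 2 * (g x - 1) ^ 2 + 2 * 4 ^ n *
        ((C + (Nk + ek)) * k x ^ 2 + C * ((1 + |x|) ^ α * k x ^ 2))) ∂μ ≤ A * eg := by
      rw [integral_add (iS.const_mul _) (ikT.const_mul _),
        integral_const_mul, integral_const_mul,
        integral_add (ik.const_mul _) (iT.const_mul _), integral_const_mul, integral_const_mul,
        ← hSdef, ← hNkdef]
      have hNk4 : Nk ≤ 4 * C * eg := by linarith
      have hQ : Nk + ek ≤ (4 * C + P) * eg := by linarith
      have h1 : (C + (Nk + ek)) * Nk ≤ C * (4 * C * eg) + (4 * C + P) * eg * 4 := by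
        have h2 : (Nk + ek) * Nk ≤ (4 * C + P) * eg * 4 := by
          gcongr
          linarith
        have h3 : C * Nk ≤ C * (4 * C * eg) := by gcongr
        linarith
      have h2 : C * ∫ x, (1 + |x|) ^ α * k x ^ 2 ∂μ ≤ C * (C * ((4 * C + P) * eg)) := by
        gcongr
        exact hT.trans (by gcongr)
      calc _ ≤ (4 ^ n + 1) ^ 2 * (C * eg) + 2 * 4 ^ n *
            ((C * (4 * C * eg) + (4 * C + P) * eg * 4) + C * (C * ((4 * C + P) * eg))) := by
            gcongr
        _ = A * eg := by rw [hA]; ring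
    calc _ = m ^ 2 * (∫ x, ((4 ^ n + 1) ^ 2 * (g x - 1) ^ 2 + 2 * 4 ^ n *
        ((C + (Nk + ek)) * k x ^ 2 + C * ((1 + |x|) ^ α * k x ^ 2))) ∂μ) +
        ∫ x, (f x ^ 2 * (m ^ 2 / N) - m ^ 2) ∂μ := by
          rw [← integral_const_mul]
          exact integral_add (iA.const_mul (m ^ 2)) iB
      _ ≤ m ^ 2 * (A * eg) := by
          rw [eB, add_zero]
          gcongr
      _ = A * e := by rw [← heg]; ring
  · filter_upwards [hlog] with x hx
    have hL : 0 ≤ C + C * (1 + |x|) ^ α + (Nk + ek) := by positivity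
    have h1 := mul_log_sub_add_one_le hn1 hL hx
    -- Variational bound for the entropy: log(f²/N) = log g² + log(m²/N), and log(m²/N) ≤ m²/N - 1.
    have h2 : f x ^ 2 * Real.log (f x ^ 2 / N) ≤
        m ^ 2 * (g x ^ 2 * Real.log (g x ^ 2)) + f x ^ 2 * (m ^ 2 / N - 1) := by
      by_cases h0 : g x = 0
      · rw [fg x, h0]; simp
      · have hg2 : g x ^ 2 ≠ 0 := pow_ne_zero _ h0
        have hmN : 0 < m ^ 2 / N := by positivity
        have e1 : f x ^ 2 / N = g x ^ 2 * (m ^ 2 / N) := by rw [fg x]; ring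
        rw [e1, Real.log_mul hg2 hmN.ne', mul_add, ← mul_assoc (m ^ 2), ← fg x]
        have := mul_le_mul_of_nonneg_left (Real.log_le_sub_one_of_pos hmN) (sq_nonneg (f x))
        linarith
    have h3 := mul_le_mul_of_nonneg_left h1 hm2.le
    change _ ≤ m ^ 2 * ((4 ^ n + 1) ^ 2 * (g x - 1) ^ 2 + 2 * 4 ^ n *
        ((C + (Nk + ek)) * k x ^ 2 + C * ((1 + |x|) ^ α * k x ^ 2))) +
        (f x ^ 2 * (m ^ 2 / N) - m ^ 2)
    have h4 := fg x
    have h5 : cut n (g x) = k x := rfl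
    rw [h5] at h3
    linarith

/-- In the case not covered by the previous lemma, f² ≤ 2(f - f(0))² + 2f(0)² and f(0)² ≤ ∫ (f -
f(0))² give ∫ f² ≤ 4 ∫ (f - f(0))², to which Hardy applies. -/
theorem exists_entropy_le (h : WeightedBounds α μ C) [IsProbabilityMeasure μ]
    (hα : 1 < α) : ∃ A : ℝ, 0 < A ∧ ∀ {f f' : ℝ → ℝ}, (∀ x, HasDerivAt f (f' x) x) →
    Continuous f' → Integrable (fun x => f x ^ 2) μ → totalEnergy α μ f f' ≠ ⊤ →
    Integrable (fun x => f x ^ 2 * Real.log (f x ^ 2 / ∫ y, f y ^ 2 ∂μ)) μ ∧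
      ∫ x, f x ^ 2 * Real.log (f x ^ 2 / ∫ y, f y ^ 2 ∂μ) ∂μ ≤
        A * (totalEnergy α μ f f').toReal := by
  have hC := h.one_le
  obtain ⟨A, hA, H⟩ := h.exists_entropy_le_of_integral_sub_lt hα
  have hA' : 0 < 4 * C * (C + 1) + 1 + C ^ 2 * (4 * C + 1) := by positivity
  refine ⟨A + (4 * C * (C + 1) + 1 + C ^ 2 * (4 * C + 1)), by linarith,
    fun {f f'} hf hf' hf2 hE => ?_⟩
  have he0 : 0 ≤ (totalEnergy α μ f f').toReal := ENNReal.toReal_nonneg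
  have hN0 : 0 ≤ ∫ x, f x ^ 2 ∂μ := integral_nonneg fun x => sq_nonneg _
  rcases hN0.eq_or_lt with hN | hN
  -- If ∫ f² = 0, division by zero makes the entropy integrand identically zero.
  · rw [← hN]
    simp only [div_zero, Real.log_zero, mul_zero, integral_zero]
    exact ⟨integrable_zero _ _ _, by positivity⟩
  · rw [add_mul]
    by_cases hlt : ∫ x, (f x - f 0) ^ 2 ∂μ < f 0 ^ 2
    · obtain ⟨h1, h2⟩ := H hf hf' hf2 hE hN hlt
      exact ⟨h1, h2.trans (le_add_of_nonneg_right (by positivity))⟩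
    · push Not at hlt
      obtain ⟨iS, hS⟩ := h.integral_sub_sq_le hf hf' hE
      have hle : ∫ x, f x ^ 2 ∂μ ≤ 4 * C * (totalEnergy α μ f f').toReal := by
        have h1 : ∫ x, f x ^ 2 ∂μ ≤ ∫ x, (2 * (f x - f 0) ^ 2 + 2 * f 0 ^ 2) ∂μ := by
          refine integral_mono hf2 ((iS.const_mul 2).add (integrable_const _)) fun x => ?_
          simp only
          nlinarith [sq_nonneg (f x - 2 * f 0)]
        rw [integral_add (iS.const_mul 2) (integrable_const _), integral_const_mul] at h1
        simp only [integral_const, probReal_univ, one_smul] at h1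
        linarith
      obtain ⟨h1, h2⟩ := h.entropy_le_of_integral_sq_le hα hf hf' hf2 hE hN hle
      exact ⟨h1, h2.trans (le_add_of_nonneg_left (by positivity))⟩

end WeightedBounds

/-! ### Comparison with H_{1,α} and the modified logarithmic Sobolev inequality. -/

theorem sq_add_rpow_le_H {α : ℝ} (hα : 1 < α) (hα2 : α ≤ 2) (t : ℝ) :
    t ^ 2 + |t| ^ α.conjExponent ≤ (4 + 2 * α.conjExponent) * H 1 α t := by
  have hβ : 2 ≤ α.conjExponent := by
    rw [Real.conjExponent, le_div_iff₀ (by linarith)]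
    linarith
  set β := α.conjExponent with hβdef
  have hβ0 : 0 < β := by linarith
  unfold H
  rw [← hβdef]
  split_ifs with h
  · have h1 : |t| ^ β ≤ t ^ 2 := by
      rw [← sq_abs t, ← Real.rpow_natCast]
      exact Real.rpow_le_rpow_of_exponent_ge_of_imp (abs_nonneg t) h (by exact_mod_cast hβ)
        (fun _ h0 => absurd h0 hβ0.ne')
    nlinarith [mul_nonneg hβ0.le (sq_nonneg t)]
  · push Not at h
    have h1 : t ^ 2 ≤ |t| ^ β := by
      rw [← sq_abs t, ← Real.rpow_natCast]
      exact Real.rpow_le_rpow_of_exponent_le h.le (by exact_mod_cast hβ)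
    rw [Real.one_rpow, one_mul, one_pow, one_mul]
    -- The additive constant in H is nonnegative because α ≤ 2 forces β ≥ 2, so it can be dropped.
    have h2 : 0 ≤ (β - 2) / (2 * β) := div_nonneg (by linarith) (by linarith)
    have h3 : 0 ≤ |t| ^ β / β := by positivity
    have h4 : 2 * β * (|t| ^ β / β) = 2 * |t| ^ β := by field_simp
    nlinarith [mul_nonneg hβ0.le h2]

/-- Absolute continuity of μ is used only at zeros of f, where `energy` contributes nothing and f'
must therefore vanish μ-almost everywhere. -/
theorem totalEnergy_le_energy {α : ℝ} (hα : 1 < α) (hα2 : α ≤ 2) {μ : Measure ℝ}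
    (hμ : μ ≪ volume) {f : ℝ → ℝ} (hf : ∀ x, HasDerivAt f (deriv f x) x) :
    totalEnergy α μ f (deriv f) ≤
      ENNReal.ofReal (4 + 2 * α.conjExponent) * energy 1 α μ f := by
  have hβ : 0 < α.conjExponent := (Real.HolderConjugate.conjExponent hα).symm.pos
  unfold totalEnergy energy
  rw [← lintegral_const_mul' _ _ ENNReal.ofReal_ne_top]
  refine lintegral_mono_ae ?_
  filter_upwards [hμ.ae_le (ae_deriv_eq_zero_of_eq_zero hf)] with x hx
  unfold HLogDeriv powEnergy
  split_ifs with h0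
  · simp [h0, hx h0]
  · rw [← mul_assoc, ← ENNReal.ofReal_mul (by positivity)]
    have h1 := sq_add_rpow_le_H hα hα2 (deriv f x / f x)
    have h2 : 0 ≤ (4 + 2 * α.conjExponent) * H 1 α (deriv f x / f x) :=
      le_trans (by positivity) h1
    rw [← ENNReal.ofReal_mul h2]
    refine ENNReal.ofReal_le_ofReal ?_
    calc _ = ((deriv f x / f x) ^ 2 + |deriv f x / f x| ^ α.conjExponent) * f x ^ 2 := by
          rw [add_mul, div_pow, div_mul_cancel₀ _ (pow_ne_zero 2 h0)]
      _ ≤ _ := by gcongr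

theorem WeightedBounds.exists_satisfiesLSI {α C : ℝ} {μ : Measure ℝ}
    (h : WeightedBounds α μ C) [IsProbabilityMeasure μ]
    (hμ : μ ≪ volume) (hα : 1 < α) (hα2 : α ≤ 2) :
    ∃ C' : ℝ, 0 < C' ∧ SatisfiesLSI 1 α C' μ := by
  have hβ : 0 < α.conjExponent := (Real.HolderConjugate.conjExponent hα).symm.pos
  obtain ⟨A, hA, H⟩ := h.exists_entropy_le hα
  refine ⟨A * (4 + 2 * α.conjExponent), by positivity, fun f hf hf2 => ?_⟩
  have hd : ∀ x, HasDerivAt f (deriv f x) x := fun x =>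
    (hf.differentiable (by simp) x).hasDerivAt
  have hc : Continuous (deriv f) := hf.continuous_deriv (by simp)
  have hle := totalEnergy_le_energy hα hα2 hμ hd
  by_cases hE : totalEnergy α μ f (deriv f) = ⊤
  · have h1 : energy 1 α μ f = ⊤ := by
      by_contra h1
      rw [hE, top_le_iff] at hle
      exact ENNReal.mul_ne_top ENNReal.ofReal_ne_top h1 hle
    rw [h1, ENNReal.mul_top (by simpa using by positivity)]
    simp
  · obtain ⟨h1, h2⟩ := H hd hc hf2.integrable_sq hE
    unfold entropy
    rw [if_pos h1]
    calc _ ≤ ((A * (totalEnergy α μ f (deriv f)).toReal : ℝ) : EReal) := by exact_mod_cast h2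
      _ = ((ENNReal.ofReal A * totalEnergy α μ f (deriv f) : ℝ≥0∞) : EReal) := by
          have e1 : ENNReal.ofReal A * totalEnergy α μ f (deriv f) =
              ENNReal.ofReal (A * (totalEnergy α μ f (deriv f)).toReal) := by
            rw [ENNReal.ofReal_mul hA.le, ENNReal.ofReal_toReal hE]
          rw [e1, EReal.coe_ennreal_ofReal, max_eq_left (by positivity)]
      _ ≤ _ := by
          rw [EReal.coe_ennreal_le_coe_ennreal_iff, ENNReal.ofReal_mul hA.le, mul_assoc]
          gcongr

/-! ### Elementary growth bounds and normalisation of densities. -/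

theorem one_add_rpow_le {α x : ℝ} (hα : 1 < α) (hα2 : α ≤ 2) (hx : 0 < x) :
    (1 + x) ^ α ≤ 4 * (1 + x ^ α) := by
  have hα0 : 0 ≤ α := by linarith
  have h1 : (1 + x) ^ α ≤ (2 * max 1 x) ^ α := by
    gcongr
    linarith [le_max_left 1 x, le_max_right 1 x]
  have h2 : (2 : ℝ) ^ α ≤ 4 := by
    calc (2 : ℝ) ^ α ≤ 2 ^ (2 : ℝ) := Real.rpow_le_rpow_of_exponent_le (by norm_num) hα2
      _ = 4 := by norm_num
  have h3 : (max 1 x) ^ α ≤ 1 + x ^ α := by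
    have := Real.rpow_nonneg hx.le α
    rcases max_choice 1 x with h | h <;> rw [h]
    · rw [Real.one_rpow]; linarith
    · linarith
  calc (1 + x) ^ α ≤ _ := h1
    _ = 2 ^ α * (max 1 x) ^ α := Real.mul_rpow (by norm_num) (by positivity)
    _ ≤ _ := by gcongr

theorem rpow_sub_one_le {α x : ℝ} (hα : 1 < α) (hα2 : α ≤ 2) (hx : 0 < x) :
    x ^ (α - 1) ≤ x ^ α / 2 + 2 := by
  have h0 := Real.rpow_nonneg hx.le α
  rcases le_total 2 x with h | h
  · rw [Real.rpow_sub_one hx.ne']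
    have : x ^ α / x ≤ x ^ α / 2 := by gcongr
    linarith
  · have : x ^ (α - 1) ≤ 2 := by
      calc x ^ (α - 1) ≤ 2 ^ (α - 1) := by gcongr
        _ ≤ 2 ^ (1 : ℝ) := Real.rpow_le_rpow_of_exponent_le (by norm_num) (by linarith)
        _ = 2 := Real.rpow_one 2
    linarith

theorem integrableOn_exp_neg {α D : ℝ} (hα : 1 < α) {V : ℝ → ℝ} (hV : Measurable V)
    (h : ∀ x, 0 < x → x ^ α / 2 - D ≤ V x) :
    IntegrableOn (fun x => Real.exp (-V x)) (Ioi 0) := by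
  have h1 := (integrableOn_rpow_mul_exp_neg_mul_rpow (p := α) (s := 0) (b := 1 / 2) (by norm_num)
    (by linarith) (by norm_num)).const_mul (Real.exp D)
  refine Integrable.mono' h1 (by fun_prop) ?_
  filter_upwards [ae_restrict_mem measurableSet_Ioi] with x hx
  rw [Real.norm_eq_abs, Real.abs_exp, Real.rpow_zero, one_mul, ← Real.exp_add]
  exact Real.exp_le_exp.2 (by linarith [h x hx])

theorem isProbabilityMeasure_withDensity_div {μ : Measure ℝ} {u : ℝ → ℝ} (hu : Integrable u μ)
    (h0 : ∀ᵐ x ∂μ, 0 ≤ u x) (hpos : 0 < ∫ x, u x ∂μ) :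
    IsProbabilityMeasure (μ.withDensity fun x => ENNReal.ofReal (u x / ∫ y, u y ∂μ)) := by
  constructor
  rw [withDensity_apply _ MeasurableSet.univ, Measure.restrict_univ,
    ← ofReal_integral_eq_lintegral_ofReal (hu.div_const _), integral_div, div_self hpos.ne',
    ENNReal.ofReal_one]
  filter_upwards [h0] with x hx
  exact div_nonneg hx hpos.le

theorem withDensity_div_eq_smul {μ : Measure ℝ} {u : ℝ → ℝ} (hu : Measurable u) {Z : ℝ}
    (hZ : 0 < Z) :
    (μ.withDensity fun x => ENNReal.ofReal (u x / Z)) =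
      ENNReal.ofReal (1 / Z) • μ.withDensity fun x => ENNReal.ofReal (u x) := by
  rw [← withDensity_smul _ (by fun_prop)]
  congr 1
  ext x
  rw [Pi.smul_apply, smul_eq_mul, ← ENNReal.ofReal_mul (by positivity)]
  congr 1
  ring

/-! ### The measures `γ_{α,b}` -/

/-- x V' = α x^α - b x/(1+x) differs from α x^α by at most |b|, and (1+x)^α ≤ 4(1 + x^α) yields c =
1/4 and B = 1 + |b|. -/
theorem halfLinePotential_gamma {α : ℝ} (hα : 1 < α) (hα2 : α ≤ 2) (b : ℝ) :
    HalfLinePotential α (fun x => x ^ α - b * Real.log (1 + x))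
      (fun x => α * x ^ α - b * (x / (1 + x))) (1 / 4) (1 + |b|) (1 + |b|) where
  c_pos := by norm_num
  B_nonneg := by positivity
  K_nonneg := by positivity
  meas := by fun_prop
  cont := by
    have h1 : ∀ x ∈ Ici (0 : ℝ), 1 + x ≠ 0 := fun x (hx : 0 ≤ x) => by positivity
    have h2 : Continuous fun x : ℝ => x ^ α := Real.continuous_rpow_const (by linarith)
    fun_prop (disch := assumption)
  q_cont := by
    have h1 : ∀ x ∈ Ici (0 : ℝ), 1 + x ≠ 0 := fun x (hx : 0 ≤ x) => by positivity
    have h2 : Continuous fun x : ℝ => x ^ α := Real.continuous_rpow_const (by linarith)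
    fun_prop (disch := assumption)
  deriv := fun x hx => by
    have h1 := Real.hasDerivAt_rpow_const (x := x) (p := α) (Or.inl hx.ne')
    have h2 := (((hasDerivAt_id x).const_add 1).log (show 1 + id x ≠ 0 by simp; positivity)).const_mul b
    refine HasDerivAt.congr_deriv (h1.sub h2) ?_
    have h3 : 1 + x ≠ 0 := by positivity
    rw [Real.rpow_sub_one hx.ne', id]
    field_simp
  q_ge := fun x hx => by
    have h1 := one_add_rpow_le hα hα2 hx
    have h0 := Real.rpow_nonneg hx.le α
    have h2 : b * (x / (1 + x)) ≤ |b| * 1 := by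
      have : x / (1 + x) ≤ 1 := by rw [div_le_one (by positivity)]; linarith
      calc _ ≤ |b| * (x / (1 + x)) := by gcongr; exact le_abs_self b
        _ ≤ _ := by gcongr
    nlinarith
  V_le := fun x hx => by
    have h1 : x ^ α ≤ (1 + x) ^ α := by gcongr; linarith
    have h3 : 1 + x ≤ (1 + x) ^ α := by
      conv_lhs => rw [← Real.rpow_one (1 + x)]
      exact Real.rpow_le_rpow_of_exponent_le (by linarith) hα.le
    have h4 : 0 ≤ Real.log (1 + x) := Real.log_nonneg (by linarith)
    have h5 := Real.log_le_sub_one_of_pos (show 0 < 1 + x by linarith)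
    have h2 : -(b * Real.log (1 + x)) ≤ |b| * (1 + x) ^ α := by
      calc _ = (-b) * Real.log (1 + x) := by ring
        _ ≤ |b| * Real.log (1 + x) := by gcongr; exact neg_le_abs b
        _ ≤ _ := by gcongr; linarith
    linarith

theorem gammaDensity_eq_exp {α b x : ℝ} (hx : 0 < x) :
    gammaDensity α b x = Real.exp (-(x ^ α - b * Real.log (1 + x))) := by
  rw [gammaDensity, Real.rpow_def_of_pos (by linarith), ← Real.exp_add]
  congr 1
  ring

theorem gamma_satisfiesLSI {α : ℝ} (hα : 1 < α) (hα2 : α ≤ 2) (b : ℝ) :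
    IsProbabilityMeasure (gamma α b) ∧ ∃ C : ℝ, 0 < C ∧ SatisfiesLSI 1 α C (gamma α b) := by
  set V : ℝ → ℝ := fun x => x ^ α - b * Real.log (1 + x) with hV
  have hP := halfLinePotential_gamma hα hα2 b
  have hae : gammaDensity α b =ᵐ[volume.restrict (Ioi 0)] fun x => Real.exp (-V x) := by
    filter_upwards [ae_restrict_mem measurableSet_Ioi] with x hx
    exact gammaDensity_eq_exp hx
  have hres : (volume : Measure ℝ).restrict (Ici 0) = volume.restrict (Ioi 0) :=
    Measure.restrict_congr_set Ioi_ae_eq_Ici.symm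
  -- Young's inequality makes |b| x, which dominates b log(1+x), smaller than x^α/2 plus a constant,
  -- so the density is integrable.
  obtain ⟨C₁, -, hY⟩ := mul_le_rpow_add_rpow hα (ε := 1 / 2) (by norm_num)
  have hi : IntegrableOn (fun x => Real.exp (-V x)) (Ioi 0) := by
    refine integrableOn_exp_neg hα hP.meas (D := C₁ * |b| ^ α.conjExponent) fun x hx => ?_
    have h1 := hY x |b| hx.le (abs_nonneg b)
    have h4 : 0 ≤ Real.log (1 + x) := Real.log_nonneg (by linarith)
    have h5 := Real.log_le_sub_one_of_pos (show 0 < 1 + x by linarith)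
    have h2 : b * Real.log (1 + x) ≤ |b| * x := by
      calc _ ≤ |b| * Real.log (1 + x) := by gcongr; exact le_abs_self b
        _ ≤ _ := by gcongr; linarith
    linarith
  have : NeZero ((volume : Measure ℝ).restrict (Ioi 0)) := ⟨by simp [Measure.restrict_eq_zero]⟩
  have hZ : 0 < ∫ x in Ioi (0 : ℝ), gammaDensity α b x := by
    rw [integral_congr_ae hae]
    exact integral_exp_pos hi
  have hprob : IsProbabilityMeasure (gamma α b) := by
    unfold gamma
    rw [hres]
    refine isProbabilityMeasure_withDensity_div (Integrable.congr hi hae.symm) ?_ hZ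
    filter_upwards [hae] with x hx
    rw [hx]
    exact (Real.exp_pos _).le
  refine ⟨hprob, ?_⟩
  obtain ⟨C, hC⟩ := hP.weightedBounds hα
  have heq : gamma α b = ENNReal.ofReal (1 / ∫ x in Ioi (0 : ℝ), gammaDensity α b x) •
      halfLineMeasure V := by
    have mV := hP.meas
    rw [halfLineMeasure, ← withDensity_div_eq_smul (by fun_prop) hZ, gamma, hres]
    refine withDensity_congr_ae ?_
    filter_upwards [hae] with x hx
    rw [hx]
  have hW := hC.smul (r := 1 / ∫ x in Ioi (0 : ℝ), gammaDensity α b x) (by positivity)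
  rw [← heq] at hW
  exact hW.exists_satisfiesLSI ((withDensity_absolutelyContinuous _ _).trans
    Measure.absolutelyContinuous_restrict) hα hα2

/-! ### The measures `τ_α` -/

/-- The sine term costs at most x^α, leaving (α-1) x^α, and x^(α-1) ≤ x^α/2 + 2 lets half of this
absorb the cosine term. What remains is (α-1)(x^α/2 - 2); then (1+x)^α ≤ 4(1 + x^α) gives c =
(α-1)/8 and B = 5(α-1)/2. -/
theorem halfLinePotential_tau {α : ℝ} (hα : 1 < α) (hα2 : α ≤ 2) :
    HalfLinePotential α (fun x => |x| ^ α + |x| ^ (α - 1) * Real.cos x)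
      (fun x => α * |x| ^ α + (α - 1) * |x| ^ (α - 1) * Real.cos x - |x| ^ α * Real.sin x)
      ((α - 1) / 8) (5 / 2 * (α - 1)) 2 where
  c_pos := by linarith
  B_nonneg := by linarith
  K_nonneg := by norm_num
  meas := by fun_prop
  cont := by
    have h1 : Continuous fun x : ℝ => |x| ^ α :=
      continuous_abs.rpow_const fun x => Or.inr (by linarith)
    have h2 : Continuous fun x : ℝ => |x| ^ (α - 1) :=
      continuous_abs.rpow_const fun x => Or.inr (by linarith)
    fun_prop
  q_cont := by
    have h1 : Continuous fun x : ℝ => |x| ^ α :=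
      continuous_abs.rpow_const fun x => Or.inr (by linarith)
    have h2 : Continuous fun x : ℝ => |x| ^ (α - 1) :=
      continuous_abs.rpow_const fun x => Or.inr (by linarith)
    fun_prop
  deriv := fun x hx => by
    have h1 := Real.hasDerivAt_rpow_const (x := x) (p := α) (Or.inl hx.ne')
    have h2 := Real.hasDerivAt_rpow_const (x := x) (p := α - 1) (Or.inl hx.ne')
    have h3 := h1.add (h2.mul (Real.hasDerivAt_cos x))
    refine (h3.congr_of_eventuallyEq ?_).congr_deriv ?_
    · filter_upwards [lt_mem_nhds hx] with z hz
      simp [abs_of_pos hz]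
    · rw [abs_of_pos hx, Real.rpow_sub_one hx.ne' (α - 1), Real.rpow_sub_one hx.ne' α]
      field_simp
      ring
  q_ge := fun x hx => by
    rw [abs_of_pos hx]
    have h1 := one_add_rpow_le hα hα2 hx
    have h2 := rpow_sub_one_le hα hα2 hx
    have h0 := Real.rpow_nonneg hx.le α
    have h0' := Real.rpow_nonneg hx.le (α - 1)
    have h3 : x ^ α * Real.sin x ≤ x ^ α :=
      mul_le_of_le_one_right h0 (Real.sin_le_one x)
    have h4 : -((α - 1) * x ^ (α - 1)) ≤ (α - 1) * x ^ (α - 1) * Real.cos x := by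
      have := mul_le_mul_of_nonneg_left (Real.neg_one_le_cos x)
        (mul_nonneg (show 0 ≤ α - 1 by linarith) h0')
      linarith
    have h5 := mul_le_mul_of_nonneg_left h1 (show 0 ≤ (α - 1) / 8 by linarith)
    have h6 := mul_le_mul_of_nonneg_left h2 (show 0 ≤ α - 1 by linarith)
    linarith
  V_le := fun x hx => by
    rw [abs_of_pos hx]
    have h0' := Real.rpow_nonneg hx.le (α - 1)
    have h1 : x ^ α ≤ (1 + x) ^ α := by gcongr; linarith
    have h2 : x ^ (α - 1) ≤ (1 + x) ^ α := by
      calc x ^ (α - 1) ≤ (1 + x) ^ (α - 1) := by gcongr; linarith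
        _ ≤ _ := Real.rpow_le_rpow_of_exponent_le (by linarith) (by linarith)
    have h3 : x ^ (α - 1) * Real.cos x ≤ x ^ (α - 1) :=
      mul_le_of_le_one_right h0' (Real.cos_le_one x)
    linarith

theorem withDensity_eq_add_map_neg {u : ℝ → ℝ≥0∞} (hu : Measurable u)
    (heven : ∀ x, u (-x) = u x) :
    volume.withDensity u = (volume.restrict (Ioi 0)).withDensity u +
      ((volume.restrict (Ioi 0)).withDensity u).map fun x => -x := by
  have hneg : MeasurePreserving (fun x : ℝ => -x) volume volume :=
    Measure.measurePreserving_neg volume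
  have h1 : ((volume.restrict (Ioi (0 : ℝ))).withDensity u).map (fun x => -x) =
      (volume.restrict (Ioi (0 : ℝ))ᶜ).withDensity u := by
    have h2 : (volume : Measure ℝ).restrict (Ioi 0)ᶜ = volume.restrict (Iio 0) := by
      rw [compl_Ioi]
      exact Measure.restrict_congr_set Iio_ae_eq_Iic.symm
    rw [h2]
    ext s hs
    rw [Measure.map_apply measurable_neg hs, withDensity_apply _ (measurable_neg hs),
      withDensity_apply _ hs, Measure.restrict_restrict (measurable_neg hs),
      Measure.restrict_restrict hs]
    have h3 : (fun x : ℝ => -x) ⁻¹' s ∩ Ioi 0 = (fun x : ℝ => -x) ⁻¹' (s ∩ Iio 0) := by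
      ext x; simp
    rw [h3, ← hneg.setLIntegral_comp_preimage (hs.inter measurableSet_Iio) hu]
    simp_rw [heven]
  rw [h1, ← withDensity_add_measure, Measure.restrict_add_restrict_compl measurableSet_Ioi]

theorem tau_satisfiesLSI {α : ℝ} (hα : 1 < α) (hα2 : α ≤ 2) :
    IsProbabilityMeasure (tau α) ∧ ∃ C : ℝ, 0 < C ∧ SatisfiesLSI 1 α C (tau α) := by
  set V : ℝ → ℝ := fun x => |x| ^ α + |x| ^ (α - 1) * Real.cos x with hV
  have hP := halfLinePotential_tau hα hα2
  have mV : Measurable V := hP.meas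
  have heq : tauDensity α = fun x => Real.exp (-V x) := by
    ext x
    rw [tauDensity, hV]
    congr 1
    ring
  have heven : ∀ x, V (-x) = V x := fun x => by simp [hV]
  have hi : IntegrableOn (fun x => Real.exp (-V x)) (Ioi 0) := by
    refine integrableOn_exp_neg hα mV (D := 2) fun x hx => ?_
    rw [hV]
    simp only
    rw [abs_of_pos hx]
    have h2 := rpow_sub_one_le hα hα2 hx
    have := mul_le_mul_of_nonneg_left (Real.neg_one_le_cos x) (Real.rpow_nonneg hx.le (α - 1))
    linarith
  have hiR : Integrable (fun x => Real.exp (-V x)) := by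
    rw [← integrableOn_univ, ← Iic_union_Ioi (a := (0 : ℝ))]
    refine IntegrableOn.union ?_ hi
    have h1 : IntegrableOn (fun x => Real.exp (-V (-x))) (Ioi 0) := by simpa only [heven] using hi
    rw [integrableOn_Iic_iff_integrableOn_Iio]
    simpa using h1.comp_neg
  have hZ : 0 < ∫ x, tauDensity α x := by
    rw [heq]
    exact integral_exp_pos hiR
  have hprob : IsProbabilityMeasure (tau α) := by
    refine isProbabilityMeasure_withDensity_div (heq ▸ hiR) ?_ hZ
    exact Filter.Eventually.of_forall fun x => (Real.exp_pos _).le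
  refine ⟨hprob, ?_⟩
  obtain ⟨C, hC⟩ := hP.weightedBounds hα
  have hτ : tau α = ENNReal.ofReal (1 / ∫ x, tauDensity α x) •
      (halfLineMeasure V + (halfLineMeasure V).map fun x => -x) := by
    rw [halfLineMeasure, ← withDensity_eq_add_map_neg (by fun_prop)
      (fun x => by simp only [heven]), ← withDensity_div_eq_smul (by fun_prop) hZ, tau, heq]
  have hW := (hC.add hC.map_neg).smul (r := 1 / ∫ x, tauDensity α x) (by positivity)
  rw [← hτ] at hW
  exact hW.exists_satisfiesLSI (withDensity_absolutelyContinuous _ _) hα hα2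

end ModLSI

theorem mainTheorem7 :
    ∃ a : ℝ, 0 < a ∧ ∀ α : ℝ, 1 < α → α ≤ 2 →
      (IsProbabilityMeasure (ModLSI.tau α) ∧
        ∃ C : ℝ, 0 < C ∧ ModLSI.SatisfiesLSI a α C (ModLSI.tau α)) ∧
      (∀ b : ℝ, IsProbabilityMeasure (ModLSI.gamma α b) ∧
        ∃ C : ℝ, 0 < C ∧ ModLSI.SatisfiesLSI a α C (ModLSI.gamma α b)) :=
  ⟨1, one_pos, fun _ hα hα2 =>
    ⟨ModLSI.tau_satisfiesLSI hα hα2, ModLSI.gamma_satisfiesLSI hα hα2⟩⟩
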